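/- **Setting.** Let $P=(p_{xy})$ be the transition matrix of an ergodic (irreducible and aperiodic) reversible Markov chain on a finite set $X$, with stationary distribution $\pi$, and let $\delta\in(0,1]$ be its eigenvalue gap, $\delta=1-\max\{|\lambda|:\lambda\ne1\text{ an eigenvalue of }P\}$ (with $\delta=1$ if $|X|=1$). Let $p^*_{yx}=\pi_xp_{xy}/\pi_y$ be the time-reversed chain. Let $M\subseteq X$ be the set of marked states, and let $\varepsilon\in(0,1]$ be such that $\pi(M)=\sum_{x\in M}\pi_x\ge\varepsilon$ whenever $M\neq\emptyset$. Each state $x$ carries data $d(x)$; write $|x\rangle_d=|x,d(x)\rangle$, and let $\bar0\in X$ be a distinguished state. The following operations on $\mathbb C^{X_d\times X_d}$, $X_d=\{(x,d(x)):x\in X\}$, have a cost: * setup cost $\mathsf S$: any unitary with $|\bar0\rangle_d|\bar0\rangle_d\mapsto\sum_x\sqrt{\pi_x}\,|x\rangle_d|\bar0\rangle_d$; * update cost $\mathsf U$: any unitary $V_1$ with $|x\rangle_d|\bar0\rangle_d\mapsto|x\rangle_d\sum_y\sqrt{p_{xy}}\,|y\rangle_d$ for all $x$, any unitary $V_2$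 with $|\bar0\rangle_d|y\rangle_d\mapsto\sum_x\sqrt{p^*_{yx}}\,|x\rangle_d|y\rangle_d$ for all $y$, and their inverses; * checking cost $\mathsf C$: the map $|x\rangle_d|y\rangle_d\mapsto-|x\rangle_d|y\rangle_d$ if $x\in M$, and identity otherwise; also testing whether an observed state is marked. Operations independent of the data (Hadamard gates, quantum Fourier transforms, reflections through $|\bar0\rangle_d$ in one register controlled by an ancilla qubit, phase flips determined by the ancilla) are not charged. **Procedure.** The quantum walk is $W(P)=\mathrm{ref}(\mathcal B)\,\mathrm{ref}(\mathcal A)$, where $\mathcal A$ and $\mathcal B$ are spanned by the vectors $V_1|x\rangle_d|\bar0\rangle_d$ and $V_2|\bar0\rangle_d|y\rangle_d$, respectively; $\mathrm{ref}(\mathcal A)=V_1\,\mathrm{ref}(\mathcal H_1)V_1^\dagger$ and $\mathrm{ref}(\mathcal B)=V_2\,\mathrm{ref}(\mathcal H_2)V_2^\dagger$, where $\mathcal H_1,\mathcal H_2$ are the spaces of states with right, respectively left, register $|\bar0\rangle_d$; so one (controlled) application of $W(P)$ or its inverse costs $4\mathsf U$. The circuit $R(P)$ with parameters $k,s$ performs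 $s$-bit phase estimation of $W(P)$ into each of $k$ blocks of $s$ ancilla qubits, flips the sign unless the median of the $k$ estimates is $0$, and undoes the phase estimations. One run of **Quantum Search**$(P)$ with parameters $k,s,t$: prepare $|\pi\rangle=\sum_x\sqrt{\pi_x}\,|x\rangle_d\sum_y\sqrt{p_{xy}}\,|y\rangle_d$ (by setup and update) with ancilla $|0^{ks}\rangle$; $t$ times, flip the phase of the states with $x\in M$ and apply $R(P)$; observe the first register; output $x$ if $x\in M$ and otherwise "no marked element exists". Repeating the procedure means making independent runs and returning the first marked element that is output, or "no marked element exists" if there is none. **Theorem.** For every $\eta>0$ there are $K\in\mathbb R$ and $r\in\mathbb N$, depending only on $\eta$, such that for all $\varepsilon,\delta\in(0,1]$ there are $k\le K\bigl(1+\log\frac1{\sqrt\varepsilon}\bigr)$, $s$ with $2^s\le K/\sqrt\delta$, $m\le K/\sqrt\varepsilon$ and a function $T:\mathbb R\to\mathbb N$ with $T\le K/\sqrt\varepsilon$, all depending only on $\eta,\varepsilon,\delta$, such that the following holds for all $X,P,\pi,d,\bar0,M$ as above and all unitaries realizing the setup and update operations. 1. (Marked probability known in advance.) Let $p$ be a real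 number with $p=\pi(M)$ if $M\ne\emptyset$, and arbitrary otherwise. If $M=\emptyset$, Quantum Search$(P)$ with $T(p)$ iterations reports with certainty that no marked element exists. If $M\neq\emptyset$, a single run outputs an element of $M$ with probability at least $\max(p,1-p)-\eta$, and $r$ repetitions output an element of $M$ with probability at least $1-\eta$. 2. (Only the lower bound $\varepsilon$ known.) If in each of $r$ repetitions the number of iterations is drawn uniformly from $\{0,\dots,m-1\}$, then the procedure reports with certainty that no marked element exists if $M=\emptyset$, and outputs an element of $M$ with probability at least $1-\eta$ if $M\ne\emptyset$. 3. (Cost.) For all $\mathsf S,\mathsf U,\mathsf C\ge0$, the cost of one run and of $r$ repetitions in 1, and the cost in 2 whatever numbers of iterations are drawn, is at most $$K\left(\mathsf S+\frac1{\sqrt\varepsilon}\left[\frac1{\sqrt\delta}\Bigl(1+\log\frac1{\sqrt\varepsilon}\Bigr)\mathsf U+\mathsf C\right]\right).$$ -/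

import Mathlib

open Matrix Finset
open scoped Kronecker

noncomputable section

namespace QuantumSearch

/-! ### Markov chains on a finite state space -/

section Chains

variable {X : Type*} [Fintype X] [DecidableEq X]

/-- Every state has period one: the only common divisor of the possible return times is `1`. -/
def IsAperiodic (P : Matrix X X ℝ) : Prop :=
  ∀ x : X, ∀ g : ℕ, (∀ n : ℕ, 0 < (P ^ n) x x → g ∣ n) → g = 1

/-- `P` is the transition matrix of an ergodic Markov chain: row-stochastic, irreducible and
aperiodic. -/
structure IsErgodicChain (P : Matrix X X ℝ) : Prop where
  stochastic : P ∈ rowStochastic ℝ X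
  irreducible : P.IsIrreducible
  aperiodic : IsAperiodic P

/-- `π` is a stationary probability distribution of `P`. -/
structure IsStationary (P : Matrix X X ℝ) (π : X → ℝ) : Prop where
  nonneg : ∀ x, 0 ≤ π x
  sum_eq_one : ∑ x, π x = 1
  stationary : π ᵥ* P = π

/-- The time-reversed chain `P*`, determined by `π x * P x y = π y * P* y x`. -/
def timeReversal (P : Matrix X X ℝ) (π : X → ℝ) : Matrix X X ℝ :=
  Matrix.of fun y x => π x * P x y / π y

/-- The chain is reversible: `P = P*`. -/
def IsReversible (P : Matrix X X ℝ) (π : X → ℝ) : Prop :=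
  P = timeReversal P π

/-- The eigenvalue gap `1 - |λ₁|`, where `|λ₁|` is the largest modulus of an eigenvalue different
from `1` (for an ergodic chain `1` is a simple eigenvalue). A chain without any other eigenvalue,
that is with one state, has gap `1`. -/
def eigenvalueGap (P : Matrix X X ℝ) : ℝ :=
  1 - sSup {a : ℝ | ∃ z : ℂ, z ≠ 1 ∧
    Module.End.HasEigenvalue (Matrix.toLin' (P.map ((↑) : ℝ → ℂ))) z ∧ a = ‖z‖}

end Chains

/-! ### States together with their data -/

/-- The set `X_d = {(x, d x) : x ∈ X}` of states with their associated data. -/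
structure Item {X D : Type*} (d : X → D) where
  pt : X
  data : D
  data_eq : data = d pt

/-- The item `(x, d x)`. -/
def item {X D : Type*} (d : X → D) (x : X) : Item d := ⟨x, d x, rfl⟩

/-- `X` and `X_d` are in bijection through `x ↦ (x, d x)`. -/
def itemEquiv {X D : Type*} (d : X → D) : X ≃ Item d where
  toFun := item d
  invFun := Item.pt
  left_inv _ := rfl
  right_inv := by rintro ⟨x, _, rfl⟩; rfl

instance {X D : Type*} [Fintype X] (d : X → D) : Fintype (Item d) :=
  Fintype.ofEquiv X (itemEquiv d)

instance {X D : Type*} [DecidableEq X] (d : X → D) : DecidableEq (Item d) :=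
  (itemEquiv d).symm.decidableEq

/-! ### The subroutines that carry a cost -/

/-- Unitary operators on `ℂ^(X_d × X_d)` that realize the setup and update transformations.
`x₀` plays the role of the distinguished state `0̄`. The transformations are only prescribed on
part of the basis, so every unitary with the prescribed values is allowed. -/
structure Subroutines {X D : Type*} [Fintype X] [DecidableEq X]
    (P : Matrix X X ℝ) (π : X → ℝ) (x₀ : X) (d : X → D) where
  /-- `|0̄⟩|0̄⟩ ↦ ∑ x, √(π x) |x⟩|0̄⟩` -/
  setup : Matrix.unitaryGroup (Item d × Item d) ℂ
  setup_spec : (setup : Matrix (Item d × Item d) (Item d × Item d) ℂ) *ᵥ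
      Pi.single (item d x₀, item d x₀) 1 =
    fun z => if z.2 = item d x₀ then ((√(π z.1.pt) : ℝ) : ℂ) else 0
  /-- `|x⟩|0̄⟩ ↦ |x⟩ ∑ y, √(P x y) |y⟩` -/
  updR : Matrix.unitaryGroup (Item d × Item d) ℂ
  updR_spec : ∀ x : Item d, (updR : Matrix (Item d × Item d) (Item d × Item d) ℂ) *ᵥ
      Pi.single (x, item d x₀) 1 =
    fun z => if z.1 = x then ((√(P x.pt z.2.pt) : ℝ) : ℂ) else 0
  /-- `|0̄⟩|y⟩ ↦ ∑ x, √(P* y x) |x⟩|y⟩` -/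
  updL : Matrix.unitaryGroup (Item d × Item d) ℂ
  updL_spec : ∀ y : Item d, (updL : Matrix (Item d × Item d) (Item d × Item d) ℂ) *ᵥ
      Pi.single (item d x₀, y) 1 =
    fun z => if z.2 = y then ((√(timeReversal P π y.pt z.1.pt) : ℝ) : ℂ) else 0

/-! ### Circuits: gates, their cost and their meaning -/

/-- Gates on the registers `X_d × X_d` and `k` blocks of `s` ancilla qubits each. -/
inductive Gate (k s : ℕ) : Type
  /-- prepare the stationary superposition -/
  | setup
  /-- update of the right register -/
  | updR
  /-- inverse of the update of the right register -/
  | updRInv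
  /-- update of the left register -/
  | updL
  /-- inverse of the update of the left register -/
  | updLInv
  /-- flip the phase if the state in the left register is marked -/
  | check
  /-- reflection through `|0̄⟩` in the right register, controlled by qubit `j` of block `i` -/
  | refR (i : Fin k) (j : Fin s)
  /-- reflection through `|0̄⟩` in the left register, controlled by qubit `j` of block `i` -/
  | refL (i : Fin k) (j : Fin s)
  /-- a Hadamard gate on each qubit of block `i` -/
  | hadamards (i : Fin k)
  /-- quantum Fourier transform on block `i` -/
  | qft (i : Fin k)
  /-- inverse quantum Fourier transform on block `i` -/
  | qftInv (i : Fin k)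
  /-- flip the phase if the median of the numbers in the `k` blocks is not zero -/
  | flipMedian

/-- The cost of a gate, for setup cost `S`, update cost `U` and checking cost `C`. Gates that are
independent of the data are not accounted for. -/
def gateCost {k s : ℕ} (S U C : ℝ) : Gate k s → ℝ
  | .setup => S
  | .updR => U
  | .updRInv => U
  | .updL => U
  | .updLInv => U
  | .check => C
  | _ => 0

/-- A circuit is the list of its gates in the order of application. -/
abbrev Circuit (k s : ℕ) : Type := List (Gate k s)

/-- The cost of a circuit is the sum of the costs of its gates. -/
def circuitCost {k s : ℕ} (S U C : ℝ) (c : Circuit k s) : ℝ := (c.map (gateCost S U C)).sum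

/-- Basis states of the ancilla: `k` blocks of `s` qubits. -/
abbrev Anc (k s : ℕ) : Type := Fin k → Fin s → Bool

/-- The number in `{0, …, 2 ^ s - 1}` with the given binary digits, least significant first. -/
def blockVal {s : ℕ} (b : Fin s → Bool) : ℕ := ∑ j, if b j then 2 ^ (j : ℕ) else 0

/-- The (lower) median of `k` numbers: the least `w` such that at least half of them are `≤ w`. -/
def median {k : ℕ} (v : Fin k → ℕ) : ℕ :=
  sInf {w : ℕ | k ≤ 2 * (Finset.univ.filter fun i => v i ≤ w).card}

/-- The operator on the ancilla that applies `A` to block `i`. -/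
def onBlock {k s : ℕ} (i : Fin k) (A : Matrix (Fin s → Bool) (Fin s → Bool) ℂ) :
    Matrix (Anc k s) (Anc k s) ℂ :=
  Matrix.of fun a b => if ∀ l, l ≠ i → a l = b l then A (a i) (b i) else 0

/-- `H ⊗ ⋯ ⊗ H` on `s` qubits. -/
def hadamardMatrix (s : ℕ) : Matrix (Fin s → Bool) (Fin s → Bool) ℂ :=
  Matrix.of fun a b => ∏ j, ((if a j && b j then -1 else 1) / ((√2 : ℝ) : ℂ))

/-- The quantum Fourier transform on `s` qubits. -/
def qftMatrix (s : ℕ) : Matrix (Fin s → Bool) (Fin s → Bool) ℂ :=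
  Matrix.of fun a b =>
    Complex.exp (2 * Real.pi * Complex.I * blockVal a * blockVal b / 2 ^ s) /
      ((√(2 ^ s) : ℝ) : ℂ)

section Semantics

variable {X D : Type*} [Fintype X] [DecidableEq X] {P : Matrix X X ℝ} {π : X → ℝ} {x₀ : X}
  {d : X → D}

/-- Basis states of the whole register. -/
abbrev Basis (d : X → D) (k s : ℕ) : Type _ := (Item d × Item d) × Anc k s

/-- The unitary operator of a gate, for the set `M` of marked states. -/
def gateMatrix (O : Subroutines P π x₀ d) (M : Finset X) {k s : ℕ} :
    Gate k s → Matrix (Basis d k s) (Basis d k s) ℂ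
  | .setup => O.setup.1 ⊗ₖ 1
  | .updR => O.updR.1 ⊗ₖ 1
  | .updRInv => O.updR.1ᴴ ⊗ₖ 1
  | .updL => O.updL.1 ⊗ₖ 1
  | .updLInv => O.updL.1ᴴ ⊗ₖ 1
  | .check => Matrix.diagonal fun b => if b.1.1.pt ∈ M then -1 else 1
  | .refR i j => Matrix.diagonal fun b => if b.2 i j ∧ b.1.2 ≠ item d x₀ then -1 else 1
  | .refL i j => Matrix.diagonal fun b => if b.2 i j ∧ b.1.1 ≠ item d x₀ then -1 else 1
  | .hadamards i => 1 ⊗ₖ onBlock i (hadamardMatrix s)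
  | .qft i => 1 ⊗ₖ onBlock i (qftMatrix s)
  | .qftInv i => 1 ⊗ₖ onBlock i (qftMatrix s)ᴴ
  | .flipMedian => Matrix.diagonal fun b => if median (fun i => blockVal (b.2 i)) = 0 then 1 else -1

/-- Run a circuit on a state. -/
def runCircuit (O : Subroutines P π x₀ d) (M : Finset X) {k s : ℕ} (c : Circuit k s)
    (ψ : Basis d k s → ℂ) : Basis d k s → ℂ :=
  c.foldl (fun φ g => gateMatrix O M g *ᵥ φ) ψ

end Semantics

/-! ### The procedure -/

section Procedure

variable {k s : ℕ}

/-- The walk `W(P) = ref(B) ref(A)`, controlled by qubit `j` of block `i`. Here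
`A = span {|x⟩|p_x⟩}` and `B = span {|p*_y⟩|y⟩}`, and each of the two reflections is realized by
undoing an update, reflecting through `|0̄⟩` in one register, and redoing the update. -/
def ctrlWalk (i : Fin k) (j : Fin s) : Circuit k s :=
  [.updRInv, .refR i j, .updR, .updLInv, .refL i j, .updL]

/-- The inverse of the controlled walk. -/
def ctrlWalkInv (i : Fin k) (j : Fin s) : Circuit k s :=
  [.updLInv, .refL i j, .updL, .updRInv, .refR i j, .updR]

/-- Phase estimation of `W(P)` with `s` bits, the estimate being written into block `i`. -/
def phaseEstimation (i : Fin k) : Circuit k s :=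
  [.hadamards i] ++
    (List.finRange s).flatMap (fun (j : Fin s) => (List.replicate (2 ^ (j : ℕ)) (ctrlWalk i j)).flatten) ++
    [.qftInv i]

/-- The inverse of phase estimation. -/
def phaseEstimationInv (i : Fin k) : Circuit k s :=
  [.qft i] ++
    (List.finRange s).reverse.flatMap
      (fun (j : Fin s) => (List.replicate (2 ^ (j : ℕ)) (ctrlWalkInv i j)).flatten) ++
    [.hadamards i]

/-- The approximate reflection `R(P)`: estimate the phase `k` times, flip the sign unless the median
estimate is zero, and undo the estimations. -/
def approxReflection (k s : ℕ) : Circuit k s :=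
  (List.finRange k).flatMap phaseEstimation ++ [.flipMedian] ++
    (List.finRange k).reverse.flatMap phaseEstimationInv

/-- The coherent part of the search: prepare `|π⟩ = ∑ x, √(π x) |x⟩|p_x⟩`, then `t` times flip the
phase of the marked states and apply `R(P)`. -/
def searchCircuit (k s t : ℕ) : Circuit k s :=
  [.setup, .updR] ++ (List.replicate t (Gate.check :: approxReflection k s)).flatten

/-- The cost of one run of the search with `t` iterations, with one more checking cost for the test
of the observed state. -/
def runCost (S U C : ℝ) (k s t : ℕ) : ℝ := circuitCost S U C (searchCircuit k s t) + C

variable {X D : Type*} [Fintype X] [DecidableEq X] {P : Matrix X X ℝ} {π : X → ℝ} {x₀ : X}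
  {d : X → D}

/-- The state before the observation, all registers being initially zero. -/
def finalState (O : Subroutines P π x₀ d) (M : Finset X) (k s t : ℕ) : Basis d k s → ℂ :=
  runCircuit O M (searchCircuit k s t) (Pi.single ((item d x₀, item d x₀), fun _ _ => false) 1)

/-- The output of the search for the observed state `x`: `some x` if `x` is marked, otherwise `none`
(no marked element exists). -/
def verdict (M : Finset X) (x : X) : Option X := if x ∈ M then some x else none

/-- The probability that one run of Quantum Search with `t` iterations has output `o`. -/
def searchProb (O : Subroutines P π x₀ d) (M : Finset X) (k s t : ℕ) (o : Option X) : ℝ :=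
  ∑ b : Basis d k s, if verdict M b.1.1.pt = o then ‖finalState O M k s t b‖ ^ 2 else 0

/-- The probability of the output `o` if the number of iterations is drawn uniformly from
`{0, …, m - 1}`. -/
def randomSearchProb (O : Subroutines P π x₀ d) (M : Finset X) (k s m : ℕ) (o : Option X) : ℝ :=
  (∑ t ∈ Finset.range m, searchProb O M k s t o) / m

/-- The output distribution of at most `r` independent runs of a procedure with output distribution
`q`: the first output different from `none` is returned, and `none` if there is no such output. -/
def repeatProb (q : Option X → ℝ) : ℕ → Option X → ℝ
  | 0, o => if o = none then 1 else 0
  | r + 1, o => (if o = none then 0 else q o) + q none * repeatProb q r o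

/-- A procedure with output distribution `q` reports `none` with certainty if no element is marked,
and otherwise outputs a marked element with probability at least `c`. -/
def FindsMarked (M : Finset X) (q : Option X → ℝ) (c : ℝ) : Prop :=
  (M = ∅ → q none = 1) ∧ (M.Nonempty → c ≤ ∑ x ∈ M, q (some x))

end Procedure

/-- The cost `S + (1/√ε) ((1/√δ) (1 + log (1/√ε)) U + C)`. -/
def targetCost (S U C ε δ : ℝ) : ℝ :=
  S + 1 / √ε * (1 / √δ * (1 + Real.log (1 / √ε)) * U + C)

end QuantumSearch

end

noncomputable section

namespace QuantumSearch

/-! The key object is the discriminant √(P x y · P y x). Reversibility makes it similar to `P`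
through the diagonal matrix of √π, so it is Hermitian with the eigenvalues of the chain, and on the
complement of √π it has norm at most 1 - δ (`norm_discriminant_le`). The two subspaces reflected by
the walk are isometric images of ℂ^X (`embR`, `embL`). Their overlap matrix is the discriminant, and
they share the image v of √π; away from v, the angle between them has cosine at most 1 - δ
(`isGapPair_emb`).

No spectral decomposition of the walk W is used. With projections A, B onto the two subspaces, ‖Wx -
x‖ = 2‖Ax - Bx‖, and `norm_sub_ge` bounds this below by 2√δ‖x‖ on the span of the parts orthogonal
to v. Telescoping the sum of the powers then gives ‖∑ W^n x‖ ≤ ‖x‖/√δ (`norm_sum_pow_le`). The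
amplitude of the phase estimate 0 is the mean of 2^s powers of W, so it is at most ‖x‖/8 once 2^s√δ
≥ 8. If the median of k estimates is 0, at least half of them are 0; weighting each zero by 64 shows
that this has probability at most 4^(-k). On v all estimates are exactly 0. So R(P) fixes v and is
within 2/2^k of -1 on that span (`norm_approxReflection_add_le`).

On lifted states the search is therefore Grover's rotation by 2θ, sin²θ = π(M), with an error 2/2^k
per iteration. It succeeds with probability at least sin²((2t+1)θ) - 4t/2^k (`sum_searchProb_ge`). A
k of order 1 + log(1/√ε) makes the loss small. What remains is trigonometry for the best and the
random t, amplification by repetition, and gate counting. -/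

lemma IsReversible.detailed_balance {X : Type*} {P : Matrix X X ℝ} {π : X → ℝ}
    (hr : IsReversible P π) (hpos : ∀ x, 0 < π x) (x y : X) :
    π x * P x y = π y * P y x := by
  have h1 : P y x = π x * P x y / π y := congrFun (congrFun hr y) x
  rw [h1]
  field_simp [(hpos y).ne']

/-- The discriminant matrix `√(P x y * P y x)` of a chain. -/
def discriminant {X : Type*} (P : Matrix X X ℝ) : Matrix X X ℂ :=
  Matrix.of fun x y => ((√(P x y) * √(P y x) : ℝ) : ℂ)

lemma discriminant_isHermitian {X : Type*} (P : Matrix X X ℝ) : (discriminant P).IsHermitian := by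
  ext x y
  simp [discriminant, mul_comm]

/-! ### The spectral gap of a reversible chain, seen on its discriminant -/

section ChainLemmas

variable {X : Type*} [Fintype X] [DecidableEq X] {P : Matrix X X ℝ} {π : X → ℝ}

lemma IsErgodicChain.nonneg (h : IsErgodicChain P) (x y : X) : 0 ≤ P x y :=
  h.irreducible.nonneg x y

lemma IsErgodicChain.exists_pow_pos (h : IsErgodicChain P) (x y : X) :
    ∃ n, 0 < (P ^ n) x y := by
  obtain ⟨n, -, hn⟩ := (isIrreducible_iff_exists_pow_pos h.irreducible.nonneg).1 h.irreducible x y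
  exact ⟨n, hn⟩

lemma IsStationary.vecMul_pow (hπ : IsStationary P π) (n : ℕ) : π ᵥ* (P ^ n) = π := by
  induction n with
  | zero => simp
  | succ n ih => rw [pow_succ, ← Matrix.vecMul_vecMul, ih, hπ.stationary]

lemma IsStationary.pos (hπ : IsStationary P π) (h : IsErgodicChain P) (y : X) : 0 < π y := by
  obtain ⟨x, hx⟩ : ∃ x, 0 < π x := by
    by_contra! hcon
    have := hπ.sum_eq_one
    have h0 : ∑ x, π x ≤ 0 := Finset.sum_nonpos fun x _ => hcon x
    linarith
  obtain ⟨n, hn⟩ := h.exists_pow_pos x y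
  have hmem := pow_mem h.stochastic n
  have h1 : π y = ∑ z, π z * (P ^ n) z y := by
    conv_lhs => rw [← hπ.vecMul_pow n]
    rfl
  rw [h1]
  exact lt_of_lt_of_le (mul_pos hx hn) (Finset.single_le_sum (f := fun z => π z * (P ^ n) z y)
    (fun z _ => mul_nonneg (hπ.nonneg z) (nonneg_of_mem_rowStochastic hmem)) (Finset.mem_univ x))

/-- Maximum principle: the value at a maximum point z is a weighted average of all values, and by
irreducibility some power of `P` gives any prescribed y positive weight. Consequently 1 is a simple
eigenvalue, so the gap sees every other eigenvector. -/
lemma IsErgodicChain.harmonic_const (h : IsErgodicChain P) {g : X → ℝ} (hg : P *ᵥ g = g)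
    (x y : X) : g x = g y := by
  have hpow : ∀ n : ℕ, (P ^ n) *ᵥ g = g := by
    intro n
    induction n with
    | zero => simp
    | succ n ih => rw [pow_succ, ← Matrix.mulVec_mulVec, hg, ih]
  have : Nonempty X := ⟨x⟩
  obtain ⟨z, hz⟩ := Finite.exists_max g
  suffices H : ∀ y, g y = g z by rw [H x, H y]
  intro y
  obtain ⟨n, hn⟩ := h.exists_pow_pos z y
  have hmem := pow_mem h.stochastic n
  have h1 : ∑ w, (P ^ n) z w * (g z - g w) = 0 := by
    have h2 : ∑ w, (P ^ n) z w * g w = g z := congrFun (hpow n) z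
    simp_rw [mul_sub, Finset.sum_sub_distrib, ← Finset.sum_mul, h2,
      sum_row_of_mem_rowStochastic hmem z]
    ring
  have h3 := (Finset.sum_eq_zero_iff_of_nonneg (fun w _ =>
    mul_nonneg (nonneg_of_mem_rowStochastic hmem) (sub_nonneg.2 (hz w)))).1 h1 y (Finset.mem_univ y)
  rcases mul_eq_zero.1 h3 with h4 | h4
  · exact absurd h4 hn.ne'
  · linarith

lemma IsErgodicChain.harmonic_const_complex (h : IsErgodicChain P) {g : X → ℂ}
    (hg : P.map ((↑) : ℝ → ℂ) *ᵥ g = g) (x y : X) : g x = g y := by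
  have hx : ∀ x, ∑ y, (P x y : ℂ) * g y = g x := fun x => congrFun hg x
  apply Complex.ext
  · refine h.harmonic_const (g := fun x => (g x).re) (funext fun x => ?_) x y
    simpa [Matrix.mulVec, dotProduct] using congrArg Complex.re (hx x)
  · refine h.harmonic_const (g := fun x => (g x).im) (funext fun x => ?_) x y
    simpa [Matrix.mulVec, dotProduct] using congrArg Complex.im (hx x)

lemma norm_le_of_hasEigenvalue {z : ℂ} (hz : z ≠ 1)
    (h : Module.End.HasEigenvalue (Matrix.toLin' (P.map ((↑) : ℝ → ℂ))) z) :
    ‖z‖ ≤ 1 - eigenvalueGap P := by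
  rw [eigenvalueGap, sub_sub_cancel]
  refine le_csSup ?_ ⟨z, hz, h, rfl⟩
  refine Set.Finite.bddAbove (Set.Finite.subset
    ((Module.End.finite_hasEigenvalue (Matrix.toLin' (P.map ((↑) : ℝ → ℂ)))).image
    (fun z : ℂ => ‖z‖)) ?_)
  rintro a ⟨z, -, h, rfl⟩
  exact ⟨z, h, rfl⟩

/-- The amplitudes `√(π x)` of the stationary superposition. -/
def sqrtVec (π : X → ℝ) : X → ℂ := fun x => ((√(π x) : ℝ) : ℂ)

lemma discriminant_eq (h : IsErgodicChain P) (hr : IsReversible P π) (hpos : ∀ x, 0 < π x)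
    (x y : X) : √(P x y) * √(P y x) = √(π x) * P x y / √(π y) := by
  have hy := Real.sqrt_pos.2 (hpos y)
  rw [eq_div_iff hy.ne']
  have e1 : √(P x y) * √(P y x) * √(π y) = √(P x y) * √(π y * P y x) := by
    rw [Real.sqrt_mul (hpos y).le]; ring
  rw [e1, ← hr.detailed_balance hpos, Real.sqrt_mul (hpos x).le]
  have := Real.mul_self_sqrt (h.nonneg x y)
  linear_combination √(π x) * this

/-- This is the similarity between the discriminant and `P`, by conjugation with the diagonal matrix
of √π. -/
lemma discriminant_mulVec (h : IsErgodicChain P) (hr : IsReversible P π) (hpos : ∀ x, 0 < π x)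
    (f : X → ℂ) :
    discriminant P *ᵥ (fun x => sqrtVec π x * f x) =
      fun x => sqrtVec π x * (P.map ((↑) : ℝ → ℂ) *ᵥ f) x := by
  funext x
  simp only [Matrix.mulVec, dotProduct, Finset.mul_sum, discriminant, Matrix.of_apply,
    Matrix.map_apply, sqrtVec]
  refine Finset.sum_congr rfl fun y _ => ?_
  rw [discriminant_eq h hr hpos]
  have : ((√(π y) : ℝ) : ℂ) ≠ 0 := by
    exact_mod_cast (Real.sqrt_pos.2 (hpos y)).ne'
  push_cast
  field_simp

/-- The spectral gap of the chain bounds its discriminant on the complement of `√π`. -/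
theorem norm_discriminant_le (h : IsErgodicChain P) (hr : IsReversible P π)
    (hpos : ∀ x, 0 < π x) (α : EuclideanSpace ℂ X)
    (hα : inner ℂ (WithLp.toLp 2 (sqrtVec π)) α = 0) :
    ‖(discriminant P).toEuclideanLin α‖ ≤ (1 - eigenvalueGap P) * ‖α‖ := by
  set D := discriminant P with hDdef
  have hD : D.IsHermitian := discriminant_isHermitian P
  set e := hD.eigenvectorBasis with he
  have hsym : D.toEuclideanLin.IsSymmetric := Matrix.isSymmetric_toEuclideanLin_iff.2 hD
  have heig : ∀ i, D.toEuclideanLin (e i) = (hD.eigenvalues i : ℂ) • e i := by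
    intro i
    have := hD.mulVec_eigenvectorBasis i
    rw [Matrix.toLpLin_apply]
    ext x
    have := congrFun this x
    simpa using this
  have hin : ∀ i, inner ℂ (e i) (D.toEuclideanLin α) = hD.eigenvalues i * inner ℂ (e i) α := by
    intro i
    rw [← hsym, heig, inner_smul_left]
    simp
  have hbound : ∀ i, ‖inner ℂ (e i) (D.toEuclideanLin α)‖ ≤
      (1 - eigenvalueGap P) * ‖inner ℂ (e i) α‖ := by
    intro i
    rw [hin, norm_mul]
    -- Undoing the similarity: f is an eigenvector of `P` itself, for the same eigenvalue.
    set f : X → ℂ := fun x => e i x / sqrtVec π x with hf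
    have hs : ∀ x, sqrtVec π x ≠ 0 := fun x => by
      simpa [sqrtVec] using (Real.sqrt_pos.2 (hpos x)).ne'
    have hfe : (fun x => sqrtVec π x * f x) = ⇑(e i) := by
      funext x
      rw [hf]; field_simp [hs x]
    have hPf : P.map ((↑) : ℝ → ℂ) *ᵥ f = (hD.eigenvalues i : ℂ) • f := by
      have h1 := discriminant_mulVec h hr hpos f
      rw [hfe] at h1
      have h2 := hD.mulVec_eigenvectorBasis i
      funext x
      have h3 := congrFun h1 x
      rw [h2] at h3
      have h4 : sqrtVec π x * (P.map ((↑) : ℝ → ℂ) *ᵥ f) x =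
        sqrtVec π x * ((hD.eigenvalues i : ℂ) * f x) := by
        rw [← h3, mul_left_comm, congrFun hfe x]
        simp only [Pi.smul_apply, Complex.real_smul]
        rfl
      simpa using mul_left_cancel₀ (hs x) h4
    -- For eigenvalue 1, f is harmonic, hence constant, so the eigenvector is a multiple of √π and α
    -- has no component along it. All other eigenvalues are controlled by the gap.
    by_cases h1 : (hD.eigenvalues i : ℂ) = 1
    · have hconst := h.harmonic_const_complex (g := f) (by rw [hPf, h1, one_smul])
      have hzero : inner ℂ (e i) α = 0 := by
        rcases isEmpty_or_nonempty X with hX | ⟨⟨x₁⟩⟩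
        · exact (hX.false i).elim
        have : e i = f x₁ • WithLp.toLp 2 (sqrtVec π) := by
          ext x
          rw [← congrFun hfe x, hconst x x₁]
          simp [mul_comm]
        rw [this, inner_smul_left, hα, mul_zero]
      simp [hzero]
    · refine mul_le_mul_of_nonneg_right (norm_le_of_hasEigenvalue h1 ?_) (norm_nonneg _)
      refine Module.End.hasEigenvalue_of_hasEigenvector (x := f) ⟨?_, ?_⟩
      · rw [Module.End.mem_eigenspace_iff, Matrix.toLin'_apply, hPf]
      · intro hf0
        apply e.orthonormal.ne_zero i
        ext x
        rw [← congrFun hfe x, hf0]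
        simp
  rcases isEmpty_or_nonempty X with hX | ⟨⟨x₁⟩⟩
  · simp [Subsingleton.elim α 0]
  -- This also covers a chain without a second eigenvalue, where the supremum of the empty set is 0.
  have hc : 0 ≤ 1 - eigenvalueGap P := by
    rw [eigenvalueGap, sub_sub_cancel]
    apply Real.sSup_nonneg
    rintro a ⟨z, -, -, rfl⟩
    exact norm_nonneg z
  rw [← sq_le_sq₀ (norm_nonneg _) (mul_nonneg hc (norm_nonneg _)), mul_pow,
    ← e.sum_sq_norm_inner_right, ← e.sum_sq_norm_inner_right α, Finset.mul_sum]
  refine Finset.sum_le_sum fun i _ => ?_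
  rw [← mul_pow]
  exact pow_le_pow_left₀ (norm_nonneg _) (hbound i) 2

end ChainLemmas

/-! ### Products of two reflections without spectral decomposition -/

section TwoProjections

variable {E : Type*} [NormedAddCommGroup E] [InnerProductSpace ℂ E]

/-- Two orthogonal projections that fix `v` and are nearly orthogonal on the complement of `v`: the
cosine of the angle between vectors in their ranges that are orthogonal to `v` is at most `c`. -/
structure IsGapPair (A B : Module.End ℂ E) (v : E) (c : ℝ) : Prop where
  symm_left : A.IsSymmetric
  symm_right : B.IsSymmetric
  idem_left : ∀ x, A (A x) = A x
  idem_right : ∀ x, B (B x) = B x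
  fix_left : A v = v
  fix_right : B v = v
  gap_left : ∀ a, A a = a → inner ℂ v a = 0 → ‖B a‖ ≤ c * ‖a‖
  gap_right : ∀ b, B b = b → inner ℂ v b = 0 → ‖A b‖ ≤ c * ‖b‖

/-- The reflection through the range of a projection. -/
def refl (A : Module.End ℂ E) : Module.End ℂ E := (2 : ℂ) • A - 1

lemma refl_apply (A : Module.End ℂ E) (x : E) : refl A x = (2 : ℂ) • A x - x := rfl

/-- The vectors that are fixed by `A` and orthogonal to `v`. -/
def fixedPerp (A : Module.End ℂ E) (v : E) : Submodule ℂ E :=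
  LinearMap.eqLocus A 1 ⊓ LinearMap.ker (innerₛₗ ℂ v)

lemma mem_fixedPerp {A : Module.End ℂ E} {v x : E} :
    x ∈ fixedPerp A v ↔ A x = x ∧ inner ℂ v x = 0 := Iff.rfl

lemma refl_refl {A : Module.End ℂ E} (hA : ∀ x, A (A x) = A x) (x : E) :
    refl A (refl A x) = x := by
  simp only [refl_apply, map_sub, map_smul, hA]
  module

lemma norm_refl {A : Module.End ℂ E} (hs : A.IsSymmetric) (hA : ∀ x, A (A x) = A x) (x : E) :
    ‖refl A x‖ = ‖x‖ := by
  have h : inner ℂ (refl A x) (refl A x) = inner ℂ x x := by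
    have h1 : inner ℂ (refl A x) (refl A x) = inner ℂ x (refl A (refl A x)) := by
      simp only [refl_apply, inner_sub_left, inner_sub_right, inner_smul_left, inner_smul_right,
        map_sub, map_smul, hs x, map_ofNat]
    rw [h1, refl_refl hA]
  rw [@norm_eq_sqrt_re_inner ℂ, h, ← @norm_eq_sqrt_re_inner ℂ]

lemma inner_fixed_eq {A : Module.End ℂ E} (hs : A.IsSymmetric) {v : E} (hv : A v = v) (x : E) :
    inner ℂ v (A x) = inner ℂ v x := by
  rw [← hs, hv]

lemma map_mem_fixedPerp {A : Module.End ℂ E} (hs : A.IsSymmetric) (hA : ∀ x, A (A x) = A x)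
    {v : E} (hv : A v = v) {x : E} (hx : inner ℂ v x = 0) : A x ∈ fixedPerp A v :=
  ⟨hA x, by simpa using (inner_fixed_eq hs hv x).trans hx⟩

lemma norm_sq_eq_of_idem {A : Module.End ℂ E} (hs : A.IsSymmetric) (hA : ∀ x, A (A x) = A x)
    (x : E) : ‖x‖ ^ 2 = ‖A x‖ ^ 2 + ‖x - A x‖ ^ 2 := by
  have h : inner ℂ (A x) (x - A x) = 0 := by
    rw [hs, map_sub, hA, sub_self, inner_zero_right]
  have := norm_add_sq_eq_norm_sq_add_norm_sq_of_inner_eq_zero (A x) (x - A x) h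
  rw [add_sub_cancel] at this
  nlinarith

namespace IsGapPair

variable {A B : Module.End ℂ E} {v : E} {c : ℝ}

/-- The space spanned by the parts of the two ranges that are orthogonal to `v`. -/
def space (_ : IsGapPair A B v c) : Submodule ℂ E := fixedPerp A v ⊔ fixedPerp B v

/-- The product of the two reflections. -/
def walk (_ : IsGapPair A B v c) : Module.End ℂ E := refl B * refl A

variable (h : IsGapPair A B v c)
include h

lemma walk_apply (x : E) : h.walk x = refl B (refl A x) := rfl

lemma norm_walk (x : E) : ‖h.walk x‖ = ‖x‖ := by
  rw [walk_apply, norm_refl h.symm_right h.idem_right, norm_refl h.symm_left h.idem_left]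

lemma norm_walk_pow (n : ℕ) (x : E) : ‖(h.walk ^ n) x‖ = ‖x‖ := by
  induction n with
  | zero => simp
  | succ n ih => rw [pow_succ', Module.End.mul_apply, norm_walk, ih]

lemma walk_fix : h.walk v = v := by
  have h2 : (2 : ℂ) • v - v = v := by module
  rw [walk_apply, refl_apply A, h.fix_left, h2, refl_apply, h.fix_right, h2]

lemma walk_pow_fix (n : ℕ) : (h.walk ^ n) v = v := by
  induction n with
  | zero => simp
  | succ n ih => rw [pow_succ', Module.End.mul_apply, ih, walk_fix]

lemma inner_eq_zero_of_mem {x : E} (hx : x ∈ h.space) : inner ℂ v x = 0 := by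
  obtain ⟨a, ha, b, hb, rfl⟩ := Submodule.mem_sup.1 hx
  rw [inner_add_right, (mem_fixedPerp.1 ha).2, (mem_fixedPerp.1 hb).2, add_zero]

lemma walk_mem {x : E} (hx : x ∈ h.space) : h.walk x ∈ h.space := by
  have h1 : refl A x ∈ h.space := by
    rw [refl_apply]
    exact sub_mem (Submodule.smul_mem _ _ (Submodule.mem_sup_left (map_mem_fixedPerp h.symm_left
      h.idem_left h.fix_left (h.inner_eq_zero_of_mem hx)))) hx
  rw [walk_apply, refl_apply]
  exact sub_mem (Submodule.smul_mem _ _ (Submodule.mem_sup_right (map_mem_fixedPerp h.symm_right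
    h.idem_right h.fix_right (h.inner_eq_zero_of_mem h1)))) h1

lemma walk_pow_mem (n : ℕ) {x : E} (hx : x ∈ h.space) : (h.walk ^ n) x ∈ h.space := by
  induction n with
  | zero => simpa
  | succ n ih => rw [pow_succ', Module.End.mul_apply]; exact h.walk_mem ih

/-- Write x = a + y with a in the range of A and y = b - Ab in its kernel, where b is in the range
of B. Then Ax - Bx splits orthogonally into a - Ba and -By. The first has squared norm ‖a‖² - ‖Ba‖²
≥ (1 - c²)‖a‖². For the second, ‖y‖² = ⟨By, b⟩ ≤ ‖By‖‖b‖ and ‖y‖² = ‖b‖² - ‖Ab‖² ≥ (1 - c²)‖b‖²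
combine to ‖By‖² ≥ (1 - c²)‖y‖². -/
lemma norm_sub_ge {x : E} (hx : x ∈ h.space) :
    (1 - c ^ 2) * ‖x‖ ^ 2 ≤ ‖A x - B x‖ ^ 2 := by
  obtain ⟨a', ha', b, hb, rfl⟩ := Submodule.mem_sup.1 hx
  obtain ⟨hb, hbv⟩ := mem_fixedPerp.1 hb
  have hAb := map_mem_fixedPerp h.symm_left h.idem_left h.fix_left hbv
  obtain ⟨ha, hav⟩ := mem_fixedPerp.1 (add_mem ha' hAb)
  obtain ⟨a, hadef⟩ : ∃ a, a = a' + A b := ⟨_, rfl⟩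
  rw [← hadef] at ha hav
  set y := b - A b with hy
  have hx' : a' + b = a + y := by rw [hadef, hy]; abel
  have hAy : A y = 0 := by rw [hy, map_sub, h.idem_left, sub_self]
  have hay : inner ℂ a y = 0 := by
    rw [← ha, h.symm_left, hAy, inner_zero_right]
  have hdiff : A (a' + b) - B (a' + b) = (a - B a) + -(B y) := by
    rw [hx', map_add, map_add, ha, hAy]; abel
  have horth : inner ℂ (a - B a) (-(B y)) = 0 := by
    rw [inner_neg_right, ← h.symm_right, map_sub, h.idem_right, sub_self, inner_zero_left,
      neg_zero]
  have n1 := norm_add_sq_eq_norm_sq_add_norm_sq_of_inner_eq_zero _ _ horth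
  have n2 := norm_add_sq_eq_norm_sq_add_norm_sq_of_inner_eq_zero _ _ hay
  have n3 := norm_sq_eq_of_idem h.symm_right h.idem_right a
  have n4 := norm_sq_eq_of_idem h.symm_left h.idem_left b
  have g1 := pow_le_pow_left₀ (norm_nonneg _) (h.gap_left a ha hav) 2
  have g2 := pow_le_pow_left₀ (norm_nonneg _) (h.gap_right b hb hbv) 2
  have hyb : ‖y‖ ^ 2 ≤ ‖B y‖ * ‖b‖ := by
    have e1 : inner ℂ y y = inner ℂ (B y) b := by
      rw [h.symm_right, hb]
      conv_lhs => rw [hy, inner_sub_right, ← hy, ← h.symm_left, hAy, inner_zero_left, sub_zero]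
    calc ‖y‖ ^ 2 = ‖inner ℂ y y‖ := by rw [inner_self_eq_norm_sq_to_K]; simp
      _ ≤ _ := by rw [e1]; exact norm_inner_le_norm _ _
  rw [hdiff, hx']
  rw [norm_neg] at n1
  have key : (1 - c ^ 2) * ‖y‖ ^ 2 ≤ ‖B y‖ ^ 2 := by
    rw [← hy] at n4
    by_cases hb0 : ‖b‖ = 0
    · have : ‖y‖ ^ 2 = 0 := by nlinarith [sq_nonneg ‖y‖, sq_nonneg ‖A b‖]
      rw [this, mul_zero]; positivity
    · have hbp : 0 < ‖b‖ ^ 2 := by positivity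
      by_contra hcon
      push Not at hcon
      by_cases hy0 : ‖y‖ ^ 2 = 0
      · rw [hy0, mul_zero] at hcon; nlinarith [sq_nonneg ‖B y‖]
      have hyp : 0 < ‖y‖ ^ 2 := by positivity
      have s1 : (‖y‖ ^ 2) ^ 2 ≤ ‖B y‖ ^ 2 * ‖b‖ ^ 2 := by
        rw [← mul_pow]; exact pow_le_pow_left₀ (by positivity) hyb 2
      have s2 : ‖B y‖ ^ 2 * ‖b‖ ^ 2 < (1 - c ^ 2) * ‖y‖ ^ 2 * ‖b‖ ^ 2 :=
        mul_lt_mul_of_pos_right hcon hbp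
      have s3 : (1 - c ^ 2) * ‖b‖ ^ 2 ≤ ‖y‖ ^ 2 := by nlinarith
      nlinarith [mul_le_mul_of_nonneg_left s3 hyp.le]
  nlinarith

/-- Since x is the B-reflection of its own B-reflection, the difference is the B-reflection of 2(Ax
- Bx), and reflections are isometric. -/
lemma norm_walk_sub (x : E) : ‖h.walk x - x‖ = 2 * ‖A x - B x‖ := by
  have h1 : h.walk x - x = refl B ((2 : ℂ) • (A x - B x)) := by
    rw [walk_apply]
    nth_rewrite 2 [← refl_refl h.idem_right x]
    rw [← map_sub]
    congr 1
    simp only [refl_apply]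
    module
  rw [h1, norm_refl h.symm_right h.idem_right, norm_smul]
  simp

/-- Averages of the powers of the walk are small on `space`. -/
lemma norm_sum_pow_le {N : ℕ} {δ : ℝ} (hδ : 0 ≤ δ) (hc : δ ≤ 1 - c ^ 2) {x : E}
    (hx : x ∈ h.space) : √δ * ‖∑ n ∈ range N, (h.walk ^ n) x‖ ≤ ‖x‖ := by
  set y := ∑ n ∈ range N, (h.walk ^ n) x
  have hy : y ∈ h.space := sum_mem fun n _ => h.walk_pow_mem n hx
  -- The sum telescopes, so W moves y by at most 2‖x‖, whereas `norm_sub_ge` says that it moves y by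
  -- at least 2√δ‖y‖.
  have h1 : h.walk y - y = (h.walk ^ N) x - x := by
    simp only [y, map_sum, ← Finset.sum_sub_distrib, ← Module.End.mul_apply, ← pow_succ']
    rw [Finset.sum_range_sub (fun n => (h.walk ^ n) x)]
    simp
  have h2 : 2 * ‖A y - B y‖ ≤ 2 * ‖x‖ := by
    rw [← h.norm_walk_sub, h1]
    refine (norm_sub_le _ _).trans ?_
    rw [norm_walk_pow]; linarith
  have h3 : (√δ * ‖y‖) ^ 2 ≤ ‖A y - B y‖ ^ 2 := by
    rw [mul_pow, Real.sq_sqrt hδ]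
    exact (mul_le_mul_of_nonneg_right hc (by positivity)).trans (h.norm_sub_ge hy)
  have h4 := abs_le_of_sq_le_sq h3 (norm_nonneg _)
  linarith [le_abs_self (√δ * ‖y‖)]

end IsGapPair

end TwoProjections

/-! ### Binary blocks, the Fourier and Hadamard transforms, operators on one block -/

section AncillaMatrices

variable {k s : ℕ}

lemma blockVal_eq_finFunctionFinEquiv (b : Fin s → Bool) :
    blockVal b = (finFunctionFinEquiv fun j => finTwoEquiv.symm (b j) : Fin (2 ^ s)) := by
  rw [finFunctionFinEquiv_apply, blockVal]
  refine Finset.sum_congr rfl fun j _ => ?_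
  cases b j <;> simp [finTwoEquiv]

/-- The binary expansion of the numbers below `2 ^ s`. -/
def blockEquiv (s : ℕ) : (Fin s → Bool) ≃ Fin (2 ^ s) :=
  (Equiv.piCongrRight fun _ => finTwoEquiv.symm).trans finFunctionFinEquiv

lemma blockEquiv_val (b : Fin s → Bool) : (blockEquiv s b : ℕ) = blockVal b :=
  (blockVal_eq_finFunctionFinEquiv b).symm

lemma sum_blockVal {A : Type*} [AddCommMonoid A] (g : ℕ → A) :
    ∑ b : Fin s → Bool, g (blockVal b) = ∑ n ∈ range (2 ^ s), g n := by
  rw [← Fin.sum_univ_eq_sum_range]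
  exact Fintype.sum_equiv (blockEquiv s) _ _ fun b => by rw [blockEquiv_val]

lemma blockVal_injective : Function.Injective (blockVal : (Fin s → Bool) → ℕ) := fun a b h =>
  (blockEquiv s).injective (Fin.ext (by rw [blockEquiv_val, blockEquiv_val, h]))

lemma blockVal_lt (b : Fin s → Bool) : blockVal b < 2 ^ s := by
  rw [← blockEquiv_val]; exact Fin.is_lt _

lemma blockVal_false : blockVal (fun _ : Fin s => false) = 0 := by simp [blockVal]

lemma blockVal_eq_zero {b : Fin s → Bool} : blockVal b = 0 ↔ b = fun _ => false :=
  ⟨fun h => blockVal_injective (h.trans blockVal_false.symm), fun h => h ▸ blockVal_false⟩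

lemma qftMatrix_apply (a b : Fin s → Bool) : qftMatrix s a b =
    Complex.exp (2 * Real.pi * Complex.I / (2 ^ s : ℕ)) ^ (blockVal a * blockVal b) /
      ((√(2 ^ s) : ℝ) : ℂ) := by
  rw [qftMatrix, Matrix.of_apply, ← Complex.exp_nat_mul]
  congr 2
  push_cast
  ring

lemma sqrt_two_pow_mul_self (s : ℕ) : ((√(2 ^ s) : ℝ) : ℂ) * ((√(2 ^ s) : ℝ) : ℂ) = 2 ^ s := by
  rw [← Complex.ofReal_mul, Real.mul_self_sqrt (by positivity)]
  push_cast; rfl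

lemma qftMatrix_mem_unitaryGroup (s : ℕ) : qftMatrix s ∈ unitaryGroup (Fin s → Bool) ℂ := by
  rw [mem_unitaryGroup_iff']
  ext a b
  set ω := Complex.exp (2 * Real.pi * Complex.I / (2 ^ s : ℕ)) with hω
  have hprim : IsPrimitiveRoot ω (2 ^ s) := Complex.isPrimitiveRoot_exp _ (by positivity)
  have hω0 : ω ≠ 0 := Complex.exp_ne_zero _
  have hconj : (starRingEnd ℂ) ω = ω⁻¹ := by
    rw [Complex.inv_eq_conj (hprim.norm'_eq_one (by positivity))]
  have hterm : ∀ c : Fin s → Bool, star (qftMatrix s) a c * qftMatrix s c b =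
      (ω ^ blockVal b / ω ^ blockVal a) ^ blockVal c / 2 ^ s := by
    intro c
    rw [star_apply, qftMatrix_apply, qftMatrix_apply, ← hω, ← sqrt_two_pow_mul_self]
    simp only [star_div₀, star_pow, Complex.star_def, hconj, Complex.conj_ofReal]
    rw [div_mul_div_comm]
    congr 1
    rw [inv_pow, div_pow, ← pow_mul, ← pow_mul]
    field_simp
    ring
  rw [mul_apply, Finset.sum_congr rfl fun c _ => hterm c,
    sum_blockVal (fun n => (ω ^ blockVal b / ω ^ blockVal a) ^ n / 2 ^ s), ← Finset.sum_div]
  by_cases hab : a = b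
  · subst hab
    simp [div_self (pow_ne_zero _ hω0)]
  · rw [one_apply_ne hab]
    -- Distinct columns give a nontrivial 2^s-th root of unity, whose geometric sum vanishes.
    set ζ := ω ^ blockVal b / ω ^ blockVal a
    have hζ : ζ ≠ 1 := by
      intro h
      rw [div_eq_one_iff_eq (pow_ne_zero _ hω0)] at h
      exact hab (blockVal_injective (hprim.pow_inj (blockVal_lt b) (blockVal_lt a) h).symm)
    have hpow : ζ ^ 2 ^ s = 1 := by
      rw [div_pow, pow_right_comm, hprim.pow_eq_one, one_pow, pow_right_comm, hprim.pow_eq_one,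
        one_pow, div_one]
    rw [geom_sum_eq hζ, hpow]
    simp

lemma hadamardMatrix_conjTranspose (s : ℕ) : (hadamardMatrix s)ᴴ = hadamardMatrix s := by
  ext a b
  simp only [hadamardMatrix, conjTranspose_apply, of_apply, Complex.star_def, map_prod, map_div₀,
    Complex.conj_ofReal]
  refine Finset.prod_congr rfl fun j _ => ?_
  rw [Bool.and_comm]
  split_ifs <;> simp

lemma hadamardMatrix_mem_unitaryGroup (s : ℕ) :
    hadamardMatrix s ∈ unitaryGroup (Fin s → Bool) ℂ := by
  rw [mem_unitaryGroup_iff', star_eq_conjTranspose, hadamardMatrix_conjTranspose]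
  ext a b
  rw [mul_apply]
  simp only [hadamardMatrix, of_apply, ← Finset.prod_mul_distrib]
  have h2 : ((√2 : ℝ) : ℂ) * ((√2 : ℝ) : ℂ) = 2 := by
    rw [← Complex.ofReal_mul, Real.mul_self_sqrt (by norm_num)]; norm_num
  have h := Finset.prod_univ_sum (fun _ : Fin s => (Finset.univ : Finset Bool))
    (fun j c => (if a j && c then -1 else 1) / ((√2 : ℝ) : ℂ) *
      ((if c && b j then -1 else 1) / ((√2 : ℝ) : ℂ)))
  rw [Fintype.piFinset_univ] at h
  rw [← h]
  have hj : ∀ j, ∑ c : Bool, (if a j && c then -1 else 1) / ((√2 : ℝ) : ℂ) *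
      ((if c && b j then -1 else 1) / ((√2 : ℝ) : ℂ)) = if a j = b j then 1 else 0 := by
    intro j
    simp only [div_mul_div_comm, h2]
    cases a j <;> cases b j <;> simp <;> norm_num
  simp_rw [hj]
  by_cases hab : a = b
  · subst hab
    simp
  · rw [one_apply_ne hab]
    obtain ⟨j, hj⟩ := Function.ne_iff.1 hab
    exact Finset.prod_eq_zero (Finset.mem_univ j) (if_neg hj)

/-- The row of a is supported on the configurations that agree with a off block i, and these are
parametrized by the content v of that block. -/
lemma sum_onBlock_mul {V : Type*} [AddCommGroup V] [Module ℂ V] (i : Fin k)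
    (A : Matrix (Fin s → Bool) (Fin s → Bool) ℂ) (φ : Anc k s → V) (a : Anc k s) :
    ∑ b, onBlock i A a b • φ b = ∑ v, A (a i) v • φ (Function.update a i v) := by
  classical
  have h1 : ∀ b : Anc k s, onBlock i A a b • φ b =
      ∑ v, if Function.update a i v = b then A (a i) v • φ b else 0 := by
    intro b
    rw [Finset.sum_eq_single (b i)]
    · by_cases h : ∀ l, l ≠ i → a l = b l
      · have hb : Function.update a i (b i) = b := by
          funext l
          by_cases hl : l = i
          · subst hl; simp
          · rw [Function.update_of_ne hl, h l hl]
        simp only [onBlock, of_apply, if_pos h, if_pos hb]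
      · have hb : Function.update a i (b i) ≠ b := by
          intro hb
          exact h fun l hl => by rw [← hb, Function.update_of_ne hl]
        simp only [onBlock, of_apply, if_neg h, if_neg hb, zero_smul]
    · intro v _ hv
      rw [if_neg]
      rintro rfl
      exact hv (by simp)
    · simp
  rw [Finset.sum_congr rfl fun b _ => h1 b, Finset.sum_comm]
  simp

lemma onBlock_mul (i : Fin k) (A B : Matrix (Fin s → Bool) (Fin s → Bool) ℂ) :
    onBlock i A * onBlock i B = onBlock i (A * B) := by
  ext a c
  rw [mul_apply]
  have := sum_onBlock_mul i A (fun b => onBlock i B b c) a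
  simp only [smul_eq_mul] at this
  rw [this]
  simp only [onBlock, of_apply, Function.update_self, mul_apply]
  have h : ∀ v, (∀ l, l ≠ i → Function.update a i v l = c l) ↔ (∀ l, l ≠ i → a l = c l) :=
    fun v => forall₂_congr fun l hl => by rw [Function.update_of_ne hl]
  simp only [h]
  split_ifs <;> simp

lemma onBlock_one (i : Fin k) : onBlock i (1 : Matrix (Fin s → Bool) (Fin s → Bool) ℂ) = 1 := by
  ext a b
  simp only [onBlock, of_apply, one_apply]
  by_cases h : a = b
  · simp [h]
  · rw [if_neg h]
    split_ifs with h1 h2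
    · exact absurd (funext fun l => by by_cases hl : l = i; exacts [hl ▸ h2, h1 l hl]) h
    all_goals rfl

lemma onBlock_conjTranspose (i : Fin k) (A : Matrix (Fin s → Bool) (Fin s → Bool) ℂ) :
    (onBlock i A)ᴴ = onBlock i Aᴴ := by
  ext a b
  simp only [onBlock, of_apply, conjTranspose_apply]
  have h : (∀ l, l ≠ i → b l = a l) ↔ (∀ l, l ≠ i → a l = b l) :=
    forall₂_congr fun l hl => eq_comm
  simp only [h]
  split_ifs <;> simp

lemma onBlock_mem_unitaryGroup (i : Fin k) {A : Matrix (Fin s → Bool) (Fin s → Bool) ℂ}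
    (hA : A ∈ unitaryGroup (Fin s → Bool) ℂ) : onBlock i A ∈ unitaryGroup (Anc k s) ℂ := by
  rw [mem_unitaryGroup_iff', star_eq_conjTranspose] at *
  rw [onBlock_conjTranspose, onBlock_mul, hA, onBlock_one]

end AncillaMatrices

/-! ### Circuits as unitary operators and their inverses -/

section Circuits

lemma diagonal_sign_mem_unitaryGroup {n : Type*} [Fintype n] [DecidableEq n] (p : n → Prop)
    [DecidablePred p] (a b : ℂ) (ha : star a * a = 1) (hb : star b * b = 1) :
    (Matrix.diagonal fun i => if p i then a else b) ∈ unitaryGroup n ℂ := by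
  rw [mem_unitaryGroup_iff', star_eq_conjTranspose, diagonal_conjTranspose, diagonal_mul_diagonal,
    ← diagonal_one]
  congr 1
  funext i
  simp only [Pi.star_apply]
  split_ifs <;> assumption

lemma norm_mulVec_of_mem_unitaryGroup {n : Type*} [Fintype n] [DecidableEq n]
    {U : Matrix n n ℂ} (hU : U ∈ unitaryGroup n ℂ) (ψ : n → ℂ) :
    ‖WithLp.toLp 2 (U *ᵥ ψ)‖ = ‖WithLp.toLp 2 ψ‖ := by
  have h : inner ℂ (WithLp.toLp 2 (U *ᵥ ψ)) (WithLp.toLp 2 (U *ᵥ ψ)) =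
      inner ℂ (WithLp.toLp 2 ψ) (WithLp.toLp 2 ψ) := by
    rw [EuclideanSpace.inner_toLp_toLp, EuclideanSpace.inner_toLp_toLp, dotProduct_comm,
      star_mulVec, dotProduct_mulVec, vecMul_vecMul, ← star_eq_conjTranspose,
      mem_unitaryGroup_iff'.1 hU, vecMul_one, dotProduct_comm]
  rw [@norm_eq_sqrt_re_inner ℂ, h, ← @norm_eq_sqrt_re_inner ℂ]

variable {X D : Type*} [Fintype X] [DecidableEq X] {P : Matrix X X ℝ} {π : X → ℝ} {x₀ : X}
  {d : X → D} {k s : ℕ}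

lemma gateMatrix_mem_unitaryGroup (O : Subroutines P π x₀ d) (M : Finset X) (g : Gate k s) :
    gateMatrix O M g ∈ unitaryGroup (Basis d k s) ℂ := by
  cases g with
  | setup => exact kronecker_mem_unitary O.setup.2 (one_mem _)
  | updR => exact kronecker_mem_unitary O.updR.2 (one_mem _)
  | updRInv => exact kronecker_mem_unitary (Unitary.star_mem O.updR.2) (one_mem _)
  | updL => exact kronecker_mem_unitary O.updL.2 (one_mem _)
  | updLInv => exact kronecker_mem_unitary (Unitary.star_mem O.updL.2) (one_mem _)
  | check => exact diagonal_sign_mem_unitaryGroup _ _ _ (by simp) (by simp)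
  | refR i j => exact diagonal_sign_mem_unitaryGroup _ _ _ (by simp) (by simp)
  | refL i j => exact diagonal_sign_mem_unitaryGroup _ _ _ (by simp) (by simp)
  | hadamards i =>
    exact kronecker_mem_unitary (one_mem _)
      (onBlock_mem_unitaryGroup i (hadamardMatrix_mem_unitaryGroup s))
  | qft i =>
    exact kronecker_mem_unitary (one_mem _)
      (onBlock_mem_unitaryGroup i (qftMatrix_mem_unitaryGroup s))
  | qftInv i =>
    exact kronecker_mem_unitary (one_mem _)
      (onBlock_mem_unitaryGroup i (Unitary.star_mem (qftMatrix_mem_unitaryGroup s)))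
  | flipMedian => exact diagonal_sign_mem_unitaryGroup _ _ _ (by simp) (by simp)

lemma runCircuit_cons (O : Subroutines P π x₀ d) (M : Finset X) (g : Gate k s) (c : Circuit k s)
    (ψ : Basis d k s → ℂ) :
    runCircuit O M (g :: c) ψ = runCircuit O M c (gateMatrix O M g *ᵥ ψ) := rfl

lemma runCircuit_append (O : Subroutines P π x₀ d) (M : Finset X) (c c' : Circuit k s)
    (ψ : Basis d k s → ℂ) :
    runCircuit O M (c ++ c') ψ = runCircuit O M c' (runCircuit O M c ψ) :=
  List.foldl_append

lemma runCircuit_add (O : Subroutines P π x₀ d) (M : Finset X) (c : Circuit k s)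
    (ψ φ : Basis d k s → ℂ) :
    runCircuit O M c (ψ + φ) = runCircuit O M c ψ + runCircuit O M c φ := by
  induction c generalizing ψ φ with
  | nil => rfl
  | cons g c ih => simp only [runCircuit_cons, mulVec_add, ih]

lemma runCircuit_smul (O : Subroutines P π x₀ d) (M : Finset X) (c : Circuit k s) (z : ℂ)
    (ψ : Basis d k s → ℂ) :
    runCircuit O M c (z • ψ) = z • runCircuit O M c ψ := by
  induction c generalizing ψ with
  | nil => rfl
  | cons g c ih => simp only [runCircuit_cons, mulVec_smul, ih]

lemma runCircuit_sub (O : Subroutines P π x₀ d) (M : Finset X) (c : Circuit k s)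
    (ψ φ : Basis d k s → ℂ) :
    runCircuit O M c (ψ - φ) = runCircuit O M c ψ - runCircuit O M c φ := by
  induction c generalizing ψ φ with
  | nil => rfl
  | cons g c ih => simp only [runCircuit_cons, mulVec_sub, ih]

lemma norm_runCircuit (O : Subroutines P π x₀ d) (M : Finset X) (c : Circuit k s)
    (ψ : Basis d k s → ℂ) :
    ‖WithLp.toLp 2 (runCircuit O M c ψ)‖ = ‖WithLp.toLp 2 ψ‖ := by
  induction c generalizing ψ with
  | nil => rfl
  | cons g c ih =>
    rw [runCircuit_cons, ih, norm_mulVec_of_mem_unitaryGroup (gateMatrix_mem_unitaryGroup O M g)]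

/-- The inverse of a gate (there is none for the setup). -/
def invGate : Gate k s → Gate k s
  | .updR => .updRInv
  | .updRInv => .updR
  | .updL => .updLInv
  | .updLInv => .updL
  | .qft i => .qftInv i
  | .qftInv i => .qft i
  | g => g

lemma gateMatrix_invGate (O : Subroutines P π x₀ d) (M : Finset X) {g : Gate k s}
    (hg : g ≠ .setup) : gateMatrix O M (invGate g) = (gateMatrix O M g)ᴴ := by
  have hdiag : ∀ (p : Basis d k s → Prop) [DecidablePred p] (a b : ℂ), star a = a → star b = b →
      (Matrix.diagonal fun i => if p i then a else b) =
        (Matrix.diagonal fun i => if p i then a else b)ᴴ := by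
    intro p _ a b ha hb
    rw [diagonal_conjTranspose]
    congr 1
    funext i
    simp only [Pi.star_apply]
    split_ifs <;> simp [ha, hb]
  cases g with
  | setup => exact absurd rfl hg
  | check => exact hdiag _ _ _ (by simp) (by simp)
  | refR i j => exact hdiag _ _ _ (by simp) (by simp)
  | refL i j => exact hdiag _ _ _ (by simp) (by simp)
  | flipMedian => exact hdiag _ _ _ (by simp) (by simp)
  | hadamards i =>
    simp [invGate, gateMatrix, conjTranspose_kronecker, onBlock_conjTranspose,
      hadamardMatrix_conjTranspose]
  | _ => simp [invGate, gateMatrix, conjTranspose_kronecker, onBlock_conjTranspose]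

/-- It makes the approximate reflection a conjugate of the median flip, so its deviation from -1 can
be measured directly after the estimations. -/
lemma runCircuit_inverse (O : Subroutines P π x₀ d) (M : Finset X) {c : Circuit k s}
    (hc : ∀ g ∈ c, g ≠ .setup) (ψ : Basis d k s → ℂ) :
    runCircuit O M (c.map invGate).reverse (runCircuit O M c ψ) = ψ := by
  induction c generalizing ψ with
  | nil => rfl
  | cons g c ih =>
    rw [List.map_cons, List.reverse_cons, runCircuit_append, runCircuit_cons O M g c,
      ih (fun g' h' => hc g' (List.mem_cons_of_mem _ h')), runCircuit_cons,
      gateMatrix_invGate O M (hc g List.mem_cons_self), mulVec_mulVec, ← star_eq_conjTranspose,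
      mem_unitaryGroup_iff'.1 (gateMatrix_mem_unitaryGroup O M g), one_mulVec]
    rfl

lemma phaseEstimationInv_eq (i : Fin k) :
    phaseEstimationInv (s := s) i = ((phaseEstimation i).map invGate).reverse := by
  simp [phaseEstimationInv, phaseEstimation, invGate, ctrlWalk, ctrlWalkInv, List.map_flatMap,
    List.reverse_flatMap, List.map_flatten, List.reverse_flatten, Function.comp_def]

lemma phaseEstimation_ne_setup (i : Fin k) : ∀ g ∈ phaseEstimation (s := s) i, g ≠ .setup := by
  intro g hg
  simp only [phaseEstimation, ctrlWalk, List.mem_append, List.mem_flatMap, List.mem_flatten,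
    List.mem_cons, List.mem_replicate, List.not_mem_nil, or_false] at hg
  rintro rfl
  rcases hg with (hg | ⟨j, -, l, ⟨-, rfl⟩, hg⟩) | hg
  all_goals simp at hg

/-- The phase estimations of the approximate reflection. -/
def estimations (k s : ℕ) : Circuit k s := (List.finRange k).flatMap phaseEstimation

lemma approxReflection_eq (k s : ℕ) : approxReflection k s =
    estimations k s ++ [.flipMedian] ++ ((estimations k s).map invGate).reverse := by
  simp only [approxReflection, estimations, List.map_flatMap, List.reverse_flatMap]
  congr 2
  funext i
  exact phaseEstimationInv_eq i

lemma estimations_inverse (O : Subroutines P π x₀ d) (M : Finset X) (ψ : Basis d k s → ℂ) :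
    runCircuit O M ((estimations k s).map invGate).reverse
      (runCircuit O M (estimations k s) ψ) = ψ := by
  refine runCircuit_inverse O M (fun g hg => ?_) ψ
  obtain ⟨i, -, hi⟩ := List.mem_flatMap.1 hg
  exact phaseEstimation_ne_setup i g hi

end Circuits

/-! ### The two isometries behind the walk, with the discriminant as their overlap -/

section Embeddings

lemma norm_toEuclideanLin_of_isometry {n m : Type*} [Fintype n] [DecidableEq n] [Fintype m]
    [DecidableEq m] {C : Matrix n m ℂ} (hC : Cᴴ * C = 1) (α : EuclideanSpace ℂ m) :
    ‖C.toEuclideanLin α‖ = ‖α‖ := by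
  have : inner ℂ (C.toEuclideanLin α) (C.toEuclideanLin α) = inner ℂ α α := by
    rw [← LinearMap.adjoint_inner_right, ← toEuclideanLin_conjTranspose_eq_adjoint,
      ← LinearMap.comp_apply, ← toLpLin_mul, hC, toLpLin_one, LinearMap.id_apply]
  rw [@norm_eq_sqrt_re_inner ℂ, this, ← @norm_eq_sqrt_re_inner ℂ]

/-- A vector in one range is Cα for an isometry C. Projecting it to the other range yields C'(Dα),
of norm ‖Dα‖, so the angle condition is exactly the norm bound for D off v. -/
lemma isGapPair_of_matrices {n m : Type*} [Fintype n] [DecidableEq n] [Fintype m] [DecidableEq m]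
    {A B : Matrix n m ℂ} {D : Matrix m m ℂ} (hA : Aᴴ * A = 1) (hB : Bᴴ * B = 1)
    (hAB : Aᴴ * B = D) (hBA : Bᴴ * A = D) {v : m → ℂ} (hv : A *ᵥ v = B *ᵥ v) {c : ℝ}
    (hD : ∀ α : EuclideanSpace ℂ m, inner ℂ (WithLp.toLp 2 v) α = 0 →
      ‖D.toEuclideanLin α‖ ≤ c * ‖α‖) :
    IsGapPair (A * Aᴴ).toEuclideanLin (B * Bᴴ).toEuclideanLin (WithLp.toLp 2 (A *ᵥ v)) c := by
  have symm : ∀ C : Matrix n m ℂ, (C * Cᴴ).toEuclideanLin.IsSymmetric := fun C =>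
    Matrix.isSymmetric_toEuclideanLin_iff.2 (isHermitian_mul_conjTranspose_self C)
  have idem : ∀ C : Matrix n m ℂ, Cᴴ * C = 1 → ∀ x, (C * Cᴴ).toEuclideanLin
      ((C * Cᴴ).toEuclideanLin x) = (C * Cᴴ).toEuclideanLin x := by
    intro C hC x
    rw [← LinearMap.comp_apply, ← toLpLin_mul, Matrix.mul_assoc, ← Matrix.mul_assoc Cᴴ, hC,
      Matrix.one_mul]
  have fix : ∀ C : Matrix n m ℂ, Cᴴ * C = 1 → (C * Cᴴ).toEuclideanLin
      (WithLp.toLp 2 (C *ᵥ v)) = WithLp.toLp 2 (C *ᵥ v) := by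
    intro C hC
    rw [toLpLin_toLp, toLin'_apply, mulVec_mulVec, Matrix.mul_assoc, hC, Matrix.mul_one]
  have gap : ∀ C C' : Matrix n m ℂ, Cᴴ * C = 1 → C'ᴴ * C' = 1 → C'ᴴ * C = D → ∀ a,
      (C * Cᴴ).toEuclideanLin a = a → inner ℂ (WithLp.toLp 2 (C *ᵥ v)) a = 0 →
      ‖(C' * C'ᴴ).toEuclideanLin a‖ ≤ c * ‖a‖ := by
    intro C C' hC hC' hCC a ha hva
    obtain ⟨α, hα⟩ : ∃ α, α = Cᴴ.toEuclideanLin a := ⟨_, rfl⟩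
    have haα : C.toEuclideanLin α = a := by
      rw [hα, ← LinearMap.comp_apply, ← toLpLin_mul, ha]
    have h0 : inner ℂ (WithLp.toLp 2 v) α = 0 := by
      rw [hα, toEuclideanLin_conjTranspose_eq_adjoint, LinearMap.adjoint_inner_right, ← hva]
      rfl
    rw [toLpLin_mul (q := 2), LinearMap.comp_apply, norm_toEuclideanLin_of_isometry hC', ← haα,
      norm_toEuclideanLin_of_isometry hC,
      ← LinearMap.comp_apply, ← toLpLin_mul, hCC]
    exact hD α h0
  refine ⟨symm A, symm B, idem A hA, idem B hB, fix A hA, ?_, gap A B hA hB hBA, ?_⟩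
  · rw [hv]; exact fix B hB
  · rw [hv]; exact gap B A hB hA hAB

lemma toEuclideanLin_two_smul_sub_one {n : Type*} [Fintype n] [DecidableEq n] (A : Matrix n n ℂ) :
    ((2 : ℂ) • A - 1).toEuclideanLin = refl A.toEuclideanLin := by
  rw [map_sub, map_smul, toLpLin_one]
  rfl

variable {X D : Type*} [Fintype X] [DecidableEq X]

/-- The isometry `|x⟩ ↦ |x⟩ ∑ y, √(P x y) |y⟩`. -/
def embR (P : Matrix X X ℝ) (d : X → D) : Matrix (Item d × Item d) X ℂ :=
  Matrix.of fun z x => if z.1.pt = x then ((√(P x z.2.pt) : ℝ) : ℂ) else 0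

/-- The isometry `|y⟩ ↦ (∑ x, √(P y x) |x⟩) |y⟩`. -/
def embL (P : Matrix X X ℝ) (d : X → D) : Matrix (Item d × Item d) X ℂ :=
  Matrix.of fun z y => if z.2.pt = y then ((√(P y z.1.pt) : ℝ) : ℂ) else 0

/-- The isometry `|x⟩ ↦ |f x⟩` for an injective map `f` of basis states. -/
def basisEmb {n m : Type*} [DecidableEq n] (f : m → n) : Matrix n m ℂ :=
  Matrix.of fun z x => if z = f x then 1 else 0

lemma basisEmb_conjTranspose_mul {n m : Type*} [Fintype n] [DecidableEq n] [DecidableEq m]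
    {f : m → n} (hf : Function.Injective f) : (basisEmb f)ᴴ * basisEmb f = 1 := by
  ext x y
  simp only [basisEmb, mul_apply, conjTranspose_apply, of_apply, one_apply]
  rw [Finset.sum_eq_single (f x)]
  · simp [hf.eq_iff]
  · intro b _ hb; simp [hb]
  · simp

lemma diagonal_eq_basisEmb {n m : Type*} [DecidableEq n] [Fintype m] {f : m → n}
    (hf : Function.Injective f) (p : n → Prop) [DecidablePred p] (hp : ∀ z, p z ↔ z ∉ Set.range f) :
    (Matrix.diagonal fun z => if p z then (-1 : ℂ) else 1) =
      (2 : ℂ) • (basisEmb f * (basisEmb f)ᴴ) - 1 := by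
  ext z w
  simp only [basisEmb, Matrix.sub_apply, Matrix.smul_apply, mul_apply, conjTranspose_apply, of_apply, one_apply,
    diagonal_apply, smul_eq_mul]
  by_cases hz : z ∈ Set.range f
  · obtain ⟨x, rfl⟩ := hz
    rw [Finset.sum_eq_single x]
    · have : ¬ p (f x) := by rw [hp]; simp
      by_cases h : f x = w
      · subst h
        simp [this]
        norm_num
      · simp [h, Ne.symm h]
    · intro b _ hb; simp [hf.ne hb.symm]
    · simp
  · have : ∀ x, z ≠ f x := fun x h => hz ⟨x, h.symm⟩
    simp [this, (hp z).2 hz]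
    split_ifs <;> simp

lemma mul_basisEmb_apply {n m : Type*} [Fintype n] [DecidableEq n] (U : Matrix n n ℂ) (f : m → n)
    (z : n) (x : m) : (U * basisEmb f) z x = (U *ᵥ Pi.single (f x) 1) z := by
  simp [basisEmb, mul_apply]

variable {P : Matrix X X ℝ} {π : X → ℝ} {x₀ : X} {d : X → D}

omit [Fintype X] [DecidableEq X] in
lemma item_pt (x : Item d) : item d x.pt = x := (itemEquiv d).apply_symm_apply x

omit [Fintype X] [DecidableEq X] in
lemma pt_item (x : X) : (item d x).pt = x := rfl

omit [Fintype X] [DecidableEq X] in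
lemma pt_eq_iff {x : Item d} {y : X} : x.pt = y ↔ x = item d y := by
  constructor
  · rintro rfl; exact (item_pt x).symm
  · rintro rfl; rfl

lemma Subroutines.embR_eq (O : Subroutines P π x₀ d) :
    embR P d = O.updR.1 * basisEmb fun x => (item d x, item d x₀) := by
  ext z x
  rw [mul_basisEmb_apply, O.updR_spec]
  simp [embR, pt_eq_iff, pt_item]

lemma Subroutines.embL_eq (hr : IsReversible P π) (O : Subroutines P π x₀ d) :
    embL P d = O.updL.1 * basisEmb fun y => (item d x₀, item d y) := by
  ext z y
  have h : timeReversal P π = P := hr.symm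
  rw [mul_basisEmb_apply, O.updL_spec, h]
  simp [embL, pt_eq_iff, pt_item]

omit [Fintype X] [DecidableEq X] in
lemma item_injective : Function.Injective (item d) := (itemEquiv d).injective

omit [Fintype X] [DecidableEq X] in
lemma item_pair_injective : Function.Injective fun x => (item d x, item d x₀) := fun _ _ h =>
  item_injective (Prod.ext_iff.1 h).1

omit [Fintype X] [DecidableEq X] in
lemma item_pair_injective' : Function.Injective fun x => (item d x₀, item d x) := fun _ _ h =>
  item_injective (Prod.ext_iff.1 h).2

lemma conjTranspose_mul_self_of_unitary {n m : Type*} [Fintype n] [DecidableEq n] [DecidableEq m]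
    {U : Matrix n n ℂ} (hU : U ∈ unitaryGroup n ℂ) {f : m → n} (hf : Function.Injective f) :
    (U * basisEmb f)ᴴ * (U * basisEmb f) = 1 := by
  rw [conjTranspose_mul, Matrix.mul_assoc, ← Matrix.mul_assoc Uᴴ, ← star_eq_conjTranspose U,
    mem_unitaryGroup_iff'.1 hU, Matrix.one_mul, basisEmb_conjTranspose_mul hf]

/-- Only the columns of `U` indexed by the range of f survive. Hence the walk does not depend on how
an update unitary is completed outside its prescribed values. -/
lemma unitary_mul_diagonal_mul {n m : Type*} [Fintype n] [DecidableEq n] [Fintype m]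
    {U : Matrix n n ℂ} (hU : U ∈ unitaryGroup n ℂ) {f : m → n} (hf : Function.Injective f)
    (p : n → Prop) [DecidablePred p] (hp : ∀ z, p z ↔ z ∉ Set.range f) :
    U * (Matrix.diagonal fun z => if p z then (-1 : ℂ) else 1) * Uᴴ =
      (2 : ℂ) • ((U * basisEmb f) * (U * basisEmb f)ᴴ) - 1 := by
  have h1 : U * Uᴴ = 1 := mem_unitaryGroup_iff.1 hU
  rw [diagonal_eq_basisEmb hf p hp, Matrix.mul_sub, Matrix.sub_mul, Matrix.mul_one, h1,
    conjTranspose_mul, Matrix.mul_smul, Matrix.smul_mul]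
  simp only [Matrix.mul_assoc]

lemma embR_conjTranspose_mul_embL : (embR P d)ᴴ * embL P d = discriminant P := by
  ext x y
  simp only [embR, embL, mul_apply, conjTranspose_apply, of_apply, discriminant]
  rw [Finset.sum_eq_single (item d x, item d y)]
  · simp [pt_item]
  · rintro ⟨z, w⟩ - hne
    by_cases hz : z.pt = x
    · by_cases hw : w.pt = y
      · exact absurd (by rw [pt_eq_iff.1 hz, pt_eq_iff.1 hw]) hne
      · simp [hw]
    · simp [hz]
  · simp

lemma embL_conjTranspose_mul_embR : (embL P d)ᴴ * embR P d = discriminant P := by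
  rw [← (discriminant_isHermitian P).eq, ← embR_conjTranspose_mul_embL (d := d), conjTranspose_mul,
    conjTranspose_conjTranspose]

lemma embR_mulVec (α : X → ℂ) (z : Item d × Item d) :
    (embR P d *ᵥ α) z = ((√(P z.1.pt z.2.pt) : ℝ) : ℂ) * α z.1.pt := by
  simp [embR, mulVec, dotProduct]

lemma embL_mulVec (α : X → ℂ) (z : Item d × Item d) :
    (embL P d *ᵥ α) z = ((√(P z.2.pt z.1.pt) : ℝ) : ℂ) * α z.2.pt := by
  simp [embL, mulVec, dotProduct]

lemma embR_conjTranspose_mul_self (O : Subroutines P π x₀ d) :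
    (embR P d)ᴴ * embR P d = 1 := by
  rw [O.embR_eq]; exact conjTranspose_mul_self_of_unitary O.updR.2 item_pair_injective

theorem isGapPair_emb (h : IsErgodicChain P) (hr : IsReversible P π) (hpos : ∀ x, 0 < π x)
    (O : Subroutines P π x₀ d) :
    IsGapPair (embR P d * (embR P d)ᴴ).toEuclideanLin (embL P d * (embL P d)ᴴ).toEuclideanLin
      (WithLp.toLp 2 (embR P d *ᵥ sqrtVec π)) (1 - eigenvalueGap P) := by
  refine isGapPair_of_matrices (embR_conjTranspose_mul_self O) ?_ embR_conjTranspose_mul_embL embL_conjTranspose_mul_embR ?_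
    (norm_discriminant_le h hr hpos)
  · rw [O.embL_eq hr]; exact conjTranspose_mul_self_of_unitary O.updL.2 item_pair_injective'
  -- Detailed balance under the square root: both isometries send √π to the same vector.
  · funext z
    rw [embR_mulVec, embL_mulVec, sqrtVec, sqrtVec, ← Complex.ofReal_mul, ← Complex.ofReal_mul,
      ← Real.sqrt_mul (h.nonneg _ _), ← Real.sqrt_mul (h.nonneg _ _), mul_comm (P _ _),
      hr.detailed_balance hpos, mul_comm (P _ _)]

end Embeddings

/-! ### The action of the walk and of phase estimation for fixed ancilla content -/

section Slices

variable {X D : Type*} [Fintype X] [DecidableEq X] {P : Matrix X X ℝ} {π : X → ℝ} {x₀ : X}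
  {d : X → D} {k s : ℕ}

/-- The part of a state in which the ancilla is in the basis state `a`. -/
def slice (Ψ : Basis d k s → ℂ) (a : Anc k s) : EuclideanSpace ℂ (Item d × Item d) :=
  WithLp.toLp 2 fun z => Ψ (z, a)

omit [DecidableEq X] in
lemma norm_sq_eq_sum_slice (Ψ : Basis d k s → ℂ) :
    ‖WithLp.toLp 2 Ψ‖ ^ 2 = ∑ a, ‖slice Ψ a‖ ^ 2 := by
  simp only [EuclideanSpace.norm_sq_eq, slice]
  rw [Fintype.sum_prod_type, Finset.sum_comm]

lemma slice_kronecker_one (G : Matrix (Item d × Item d) (Item d × Item d) ℂ) (Ψ : Basis d k s → ℂ)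
    (a : Anc k s) : slice ((G ⊗ₖ (1 : Matrix (Anc k s) (Anc k s) ℂ)) *ᵥ Ψ) a =
      G.toEuclideanLin (slice Ψ a) := by
  ext z
  simp [slice, mulVec, dotProduct, Fintype.sum_prod_type, one_apply, kroneckerMap_apply]

lemma slice_one_kronecker_onBlock (i : Fin k) (A : Matrix (Fin s → Bool) (Fin s → Bool) ℂ)
    (Ψ : Basis d k s → ℂ) (a : Anc k s) :
    slice (((1 : Matrix (Item d × Item d) (Item d × Item d) ℂ) ⊗ₖ onBlock i A) *ᵥ Ψ) a =
      ∑ v, A (a i) v • slice Ψ (Function.update a i v) := by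
  ext z
  have h := sum_onBlock_mul i A (fun b => Ψ (z, b)) a
  simp only [smul_eq_mul] at h
  rw [WithLp.ofLp_sum, Finset.sum_apply]
  simp only [slice, WithLp.ofLp_smul, Pi.smul_apply, smul_eq_mul]
  rw [← h, mulVec, dotProduct, Fintype.sum_prod_type, Finset.sum_eq_single z]
  · simp [kroneckerMap_apply]
  · intro w _ hw
    simp [kroneckerMap_apply, one_apply_ne hw.symm]
  · simp

lemma slice_diagonal (f : Basis d k s → ℂ) (Ψ : Basis d k s → ℂ) (a : Anc k s) :
    slice (Matrix.diagonal f *ᵥ Ψ) a =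
      (Matrix.diagonal fun z => f (z, a)).toEuclideanLin (slice Ψ a) := by
  ext z
  simp [slice, mulVec_diagonal]

/-- The two projections whose reflections make up the walk. -/
abbrev projR (P : Matrix X X ℝ) (d : X → D) :
    Module.End ℂ (EuclideanSpace ℂ (Item d × Item d)) :=
  (embR P d * (embR P d)ᴴ).toEuclideanLin

/-- See `projR`. -/
abbrev projL (P : Matrix X X ℝ) (d : X → D) :
    Module.End ℂ (EuclideanSpace ℂ (Item d × Item d)) :=
  (embL P d * (embL P d)ᴴ).toEuclideanLin

lemma toEuclideanLin_conj {n : Type*} [Fintype n] [DecidableEq n] (U V W : Matrix n n ℂ)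
    (x : EuclideanSpace ℂ n) : U.toEuclideanLin (V.toEuclideanLin (W.toEuclideanLin x)) =
      (U * V * W).toEuclideanLin x := by
  rw [toLpLin_mul_same, toLpLin_mul_same]
  rfl

omit [Fintype X] [DecidableEq X] in
lemma mem_range_item_right (z : Item d × Item d) :
    z.2 ≠ item d x₀ ↔ z ∉ Set.range fun x => (item d x, item d x₀) := by
  rw [not_iff_not]
  constructor
  · intro h; exact ⟨z.1.pt, Prod.ext (item_pt _) h.symm⟩
  · rintro ⟨x, rfl⟩; rfl

omit [Fintype X] [DecidableEq X] in
lemma mem_range_item_left (z : Item d × Item d) :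
    z.1 ≠ item d x₀ ↔ z ∉ Set.range fun x => (item d x₀, item d x) := by
  rw [not_iff_not]
  constructor
  · intro h; exact ⟨z.2.pt, Prod.ext h.symm (item_pt _)⟩
  · rintro ⟨x, rfl⟩; rfl

lemma slice_ctrlWalk (hr : IsReversible P π) (O : Subroutines P π x₀ d) (M : Finset X)
    (i : Fin k) (j : Fin s) (Ψ : Basis d k s → ℂ) (a : Anc k s) :
    slice (runCircuit O M (ctrlWalk i j) Ψ) a =
      if a i j then (refl (projL P d) * refl (projR P d)) (slice Ψ a) else slice Ψ a := by
  have hR : O.updR.1 * O.updR.1ᴴ = 1 := mem_unitaryGroup_iff.1 O.updR.2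
  have hL : O.updL.1 * O.updL.1ᴴ = 1 := mem_unitaryGroup_iff.1 O.updL.2
  simp only [ctrlWalk, runCircuit_cons, gateMatrix]
  change slice ((O.updL.1 ⊗ₖ 1) *ᵥ _) a = _
  rw [slice_kronecker_one, slice_diagonal, slice_kronecker_one, slice_kronecker_one,
    slice_diagonal, slice_kronecker_one, toEuclideanLin_conj O.updR.1, toEuclideanLin_conj O.updL.1]
  split_ifs with h
  · simp only [h, true_and]
    rw [unitary_mul_diagonal_mul O.updR.2 (item_pair_injective (x₀ := x₀)) _ mem_range_item_right,
      unitary_mul_diagonal_mul O.updL.2 (item_pair_injective' (x₀ := x₀)) _ mem_range_item_left,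
      ← O.embR_eq, ← O.embL_eq hr, toEuclideanLin_two_smul_sub_one,
      toEuclideanLin_two_smul_sub_one]
    rfl
  -- With the control off, the diagonal gates are trivial and each update cancels against its
  -- inverse.
  · simp [h, hR, hL]

lemma slice_walks (hr : IsReversible P π) (O : Subroutines P π x₀ d) (M : Finset X)
    (i : Fin k) (j : Fin s) (n : ℕ) (Ψ : Basis d k s → ℂ) (a : Anc k s) :
    slice (runCircuit O M (List.replicate n (ctrlWalk i j)).flatten Ψ) a =
      ((refl (projL P d) * refl (projR P d)) ^ (if a i j then n else 0)) (slice Ψ a) := by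
  induction n generalizing Ψ with
  | zero => simp; rfl
  | succ n ih =>
    rw [List.replicate_succ, List.flatten_cons, runCircuit_append, ih, slice_ctrlWalk hr]
    split_ifs
    · rw [pow_succ]; rfl
    · rfl

lemma slice_all_walks (hr : IsReversible P π) (O : Subroutines P π x₀ d) (M : Finset X)
    (i : Fin k) (l : List (Fin s)) (Ψ : Basis d k s → ℂ) (a : Anc k s) :
    slice (runCircuit O M
      (l.flatMap fun (j : Fin s) => (List.replicate (2 ^ (j : ℕ)) (ctrlWalk i j)).flatten) Ψ) a =
      ((refl (projL P d) * refl (projR P d)) ^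
        (l.map fun (j : Fin s) => if a i j then 2 ^ (j : ℕ) else 0).sum) (slice Ψ a) := by
  induction l generalizing Ψ with
  | nil => simp; rfl
  | cons j l ih =>
    rw [List.flatMap_cons, runCircuit_append, ih, slice_walks hr, List.map_cons, List.sum_cons,
      add_comm, pow_add]
    rfl

/-- Qubit j contributes 2^j walks when it is set, so block content u applies the walk exactly
`blockVal u` times. -/
lemma slice_phaseEstimation (hr : IsReversible P π) (O : Subroutines P π x₀ d) (M : Finset X)
    (i : Fin k) (Ψ : Basis d k s → ℂ) (a : Anc k s) :
    slice (runCircuit O M (phaseEstimation i) Ψ) a = ∑ u, (qftMatrix s)ᴴ (a i) u •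
      ((refl (projL P d) * refl (projR P d)) ^ blockVal u)
        (∑ v, hadamardMatrix s u v • slice Ψ (Function.update a i v)) := by
  rw [phaseEstimation, runCircuit_append, runCircuit_append]
  change slice ((1 ⊗ₖ onBlock i (qftMatrix s)ᴴ) *ᵥ _) a = _
  rw [slice_one_kronecker_onBlock]
  refine Finset.sum_congr rfl fun u _ => ?_
  rw [slice_all_walks hr]
  congr 1
  have h1 : ((List.finRange s).map fun (j : Fin s) => if Function.update a i u i j then 2 ^ (j : ℕ)
      else 0).sum = blockVal u := by
    rw [blockVal, Fin.sum_univ_def]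
    simp
  rw [h1]
  congr 1
  change slice ((1 ⊗ₖ onBlock i (hadamardMatrix s)) *ᵥ _) _ = _
  rw [slice_one_kronecker_onBlock]
  simp

end Slices

/-! ### The probability of a false zero in a single phase estimation -/

section Estimates

lemma sum_norm_sq_of_mem_unitaryGroup {E n : Type*} [NormedAddCommGroup E] [InnerProductSpace ℂ E]
    [Fintype n] [DecidableEq n] {U : Matrix n n ℂ} (hU : U ∈ unitaryGroup n ℂ) (φ : n → E) :
    ∑ v, ‖∑ u, U v u • φ u‖ ^ 2 = ∑ u, ‖φ u‖ ^ 2 := by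
  have key : ∑ v, inner ℂ (∑ u, U v u • φ u) (∑ u, U v u • φ u) = ∑ u, inner ℂ (φ u) (φ u) := by
    have h : ∀ u w, ∑ v, U v u * ((starRingEnd ℂ) (U v w) * inner ℂ (φ w) (φ u)) =
        if w = u then inner ℂ (φ w) (φ u) else 0 := by
      intro u w
      have h1 := congrFun (congrFun (mem_unitaryGroup_iff'.1 hU) w) u
      rw [mul_apply, one_apply] at h1
      simp only [star_apply, Complex.star_def] at h1
      rw [← one_mul (inner ℂ (φ w) (φ u)), ← ite_zero_mul, ← h1, Finset.sum_mul]
      exact Finset.sum_congr rfl fun v _ => by ring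
    simp only [sum_inner, inner_sum, inner_smul_left, inner_smul_right, Finset.mul_sum]
    rw [Finset.sum_comm]
    refine Finset.sum_congr rfl fun u _ => ?_
    rw [Finset.sum_comm, Finset.sum_congr rfl fun w _ => h u w]
    simp
  simp only [inner_self_eq_norm_sq_to_K] at key
  exact_mod_cast key

variable {E : Type*} [NormedAddCommGroup E] [InnerProductSpace ℂ E]
  {A B : Module.End ℂ E} {v : E} {c : ℝ} {s : ℕ}

/-- The component of the state after phase estimation in which the estimate is `b`. -/
def estimate (W : Module.End ℂ E) (b : Fin s → Bool) (x : E) : E :=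
  ∑ u, (qftMatrix s)ᴴ b u • (W ^ blockVal u) (((√(2 ^ s) : ℝ) : ℂ)⁻¹ • x)

namespace IsGapPair

lemma sum_norm_sq_estimate (h : IsGapPair A B v c) (x : E) :
    ∑ b : Fin s → Bool, ‖estimate h.walk b x‖ ^ 2 = ‖x‖ ^ 2 := by
  simp only [estimate, ← star_eq_conjTranspose]
  rw [sum_norm_sq_of_mem_unitaryGroup (Unitary.star_mem (qftMatrix_mem_unitaryGroup s))
    fun u => (h.walk ^ blockVal u) (((√(2 ^ s) : ℝ) : ℂ)⁻¹ • x)]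
  simp only [norm_walk_pow, norm_smul, norm_inv, Complex.norm_real, Real.norm_eq_abs,
    abs_of_nonneg (Real.sqrt_nonneg _), mul_pow, inv_pow]
  rw [Real.sq_sqrt (by positivity), Finset.sum_const, Finset.card_univ]
  simp

lemma estimate_mem (h : IsGapPair A B v c) (b : Fin s → Bool) {x : E} (hx : x ∈ h.space) :
    estimate h.walk b x ∈ h.space :=
  sum_mem fun _ _ => Submodule.smul_mem _ _ (h.walk_pow_mem _ (Submodule.smul_mem _ _ hx))

/-- The Fourier row of index 0 is constant, so the outcome zero carries the mean of the powers, to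
which the telescoping bound applies. -/
lemma estimate_false (W : Module.End ℂ E) (x : E) :
    estimate W (fun _ : Fin s => false) x =
      ((2 : ℂ) ^ s)⁻¹ • ∑ n ∈ range (2 ^ s), (W ^ n) x := by
  rw [estimate, ← sum_blockVal fun n => (W ^ n) x, Finset.smul_sum]
  refine Finset.sum_congr rfl fun u _ => ?_
  rw [conjTranspose_apply, qftMatrix_apply, blockVal_false, map_smul, smul_smul]
  congr 1
  rw [← sqrt_two_pow_mul_self, mul_inv]
  simp

lemma estimate_fix (h : IsGapPair A B v c) (b : Fin s → Bool) :
    estimate h.walk b v = if b = fun _ => false then v else 0 := by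
  have h0 : estimate h.walk (fun _ : Fin s => false) v = v := by
    rw [estimate_false]
    simp only [walk_pow_fix, Finset.sum_const, card_range, ← Nat.cast_smul_eq_nsmul ℂ, smul_smul]
    simp
  split_ifs with hb
  · rw [hb, h0]
  -- The outcome zero already carries the full norm of v, so conservation of norm kills every other
  -- outcome.
  · have hsum := h.sum_norm_sq_estimate (s := s) v
    rw [← Finset.add_sum_erase _ _ (Finset.mem_univ fun _ : Fin s => false), h0] at hsum
    have h1 := (Finset.sum_eq_zero_iff_of_nonneg fun b _ => sq_nonneg _).1
      (add_eq_left.1 hsum) b (Finset.mem_erase.2 ⟨hb, Finset.mem_univ b⟩)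
    simpa using h1

/-- A weight that penalizes the estimate zero. -/
def zeroWeight (b : Fin s → Bool) : ℝ := if b = fun _ => false then 64 else 1

lemma zeroWeight_nonneg (b : Fin s → Bool) : 0 ≤ zeroWeight b := by
  unfold zeroWeight; split_ifs <;> norm_num

/-- The zero outcome has probability at most 1/64 relative to ‖x‖², so raising its weight from 1 to
64 adds at most 63/64. -/
lemma sum_zeroWeight_estimate_le (h : IsGapPair A B v c) {δ : ℝ} (hδ : 0 < δ)
    (hc : δ ≤ 1 - c ^ 2) (hs : 8 ≤ 2 ^ s * √δ) {x : E} (hx : x ∈ h.space) :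
    ∑ b : Fin s → Bool, zeroWeight b * ‖estimate h.walk b x‖ ^ 2 ≤ 2 * ‖x‖ ^ 2 := by
  have h1 : ∀ b : Fin s → Bool, zeroWeight b * ‖estimate h.walk b x‖ ^ 2 =
      ‖estimate h.walk b x‖ ^ 2 +
        if b = fun _ => false then 63 * ‖estimate h.walk b x‖ ^ 2 else 0 := by
    intro b
    unfold zeroWeight
    split_ifs <;> ring
  rw [Finset.sum_congr rfl fun b _ => h1 b, Finset.sum_add_distrib, sum_norm_sq_estimate]
  simp only [Finset.sum_ite_eq', Finset.mem_univ, if_true]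
  have h2 : 8 * ‖estimate h.walk (fun _ : Fin s => false) x‖ ≤ ‖x‖ := by
    have h3 := h.norm_sum_pow_le (N := 2 ^ s) hδ.le hc hx
    set y := ∑ n ∈ range (2 ^ s), (h.walk ^ n) x
    have hp : (0 : ℝ) < 2 ^ s := by positivity
    rw [estimate_false, norm_smul, norm_inv, norm_pow, Complex.norm_ofNat, ← mul_assoc,
      ← div_eq_mul_inv]
    refine le_trans (mul_le_mul_of_nonneg_right ?_ (norm_nonneg y)) h3
    rw [div_le_iff₀ hp]
    linarith
  nlinarith [norm_nonneg (estimate h.walk (fun _ : Fin s => false) x), norm_nonneg x]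

end IsGapPair

end Estimates

/-! ### Median amplification and the approximate reflection -/

section ApproxReflection

/-- Configurations are grouped by their values off coordinate i, the one with value b₀ representing
its group. With b₀ the zero block, this isolates the outcomes of one estimation. -/
lemma sum_eq_sum_update {ι β : Type*} [Fintype ι] [DecidableEq ι] [Fintype β] [DecidableEq β]
    (i : ι) (b₀ : β) (F : (ι → β) → ℝ) :
    ∑ a, F a = ∑ a : ι → β, if a i = b₀ then ∑ b, F (Function.update a i b) else 0 := by
  rw [← Finset.sum_filter, ← Finset.sum_product']
  refine Finset.sum_bij' (fun a _ => (Function.update a i b₀, a i))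
    (fun p _ => Function.update p.1 i p.2) ?_ ?_ ?_ ?_ ?_
  · intro a _; simp
  · intro p _; simp
  · intro a _; simp
  · rintro ⟨a, b⟩ hp
    have : a i = b₀ := by simpa using hp
    simp [← this]
  · intro a _; simp

lemma median_zero (k : ℕ) : median (fun _ : Fin k => 0) = 0 := by
  refine Nat.sInf_eq_zero.2 (Or.inl ?_)
  simp
  omega

lemma le_two_mul_card_of_median_eq_zero {k : ℕ} {v : Fin k → ℕ} (h : median v = 0) :
    k ≤ 2 * (Finset.univ.filter fun i => v i = 0).card := by
  -- The infimum of the empty set would also be 0, so the infimum must first be known to be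
  -- attained.
  have hne : {w : ℕ | k ≤ 2 * (Finset.univ.filter fun i => v i ≤ w).card}.Nonempty := by
    refine ⟨∑ i, v i, ?_⟩
    have : (Finset.univ.filter fun i => v i ≤ ∑ i, v i) = Finset.univ :=
      Finset.filter_true_of_mem fun i _ => Finset.single_le_sum (fun _ _ => Nat.zero_le _)
        (Finset.mem_univ i)
    simp only [Set.mem_ofPred_eq, this, Finset.card_univ, Fintype.card_fin]
    omega
  have := Nat.sInf_mem hne
  rw [median] at h
  rw [h] at this
  simpa using this

variable {X D : Type*} [Fintype X] [DecidableEq X] {P : Matrix X X ℝ} {π : X → ℝ} {x₀ : X}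
  {d : X → D} {k s : ℕ}

omit [Fintype X] [DecidableEq X] in
lemma slice_ext {Ψ Φ : Basis d k s → ℂ} (h : ∀ a, slice Ψ a = slice Φ a) : Ψ = Φ := by
  funext ⟨z, a⟩
  have := congrArg (fun x : EuclideanSpace ℂ (Item d × Item d) => x z) (h a)
  simpa [slice] using this

/-- The state `x` of the two registers, the ancilla being zero. -/
def withZero (k s : ℕ) (x : EuclideanSpace ℂ (Item d × Item d)) : Basis d k s → ℂ :=
  fun b => if b.2 = fun _ _ => false then x b.1 else 0

omit [Fintype X] [DecidableEq X] in
lemma slice_withZero (x : EuclideanSpace ℂ (Item d × Item d)) (a : Anc k s) :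
    slice (withZero k s x) a = if a = fun _ _ => false then x else 0 := by
  ext z
  simp only [slice, withZero]
  split_ifs <;> simp

omit [DecidableEq X] in
lemma norm_withZero (x : EuclideanSpace ℂ (Item d × Item d)) :
    ‖WithLp.toLp 2 (withZero k s x)‖ = ‖x‖ := by
  rw [← sq_eq_sq₀ (norm_nonneg _) (norm_nonneg _), norm_sq_eq_sum_slice]
  simp only [slice_withZero, apply_ite norm, ite_pow]
  simp

omit [Fintype X] [DecidableEq X] in
lemma withZero_add (x y : EuclideanSpace ℂ (Item d × Item d)) :
    withZero k s (x + y) = withZero k s x + withZero k s y := by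
  funext b
  simp only [withZero, Pi.add_apply]
  split_ifs <;> simp

omit [Fintype X] [DecidableEq X] in
lemma withZero_smul (z : ℂ) (x : EuclideanSpace ℂ (Item d × Item d)) :
    withZero k s (z • x) = z • withZero k s x := by
  funext b
  simp only [withZero, Pi.smul_apply]
  split_ifs <;> simp

lemma hadamardMatrix_apply_false (u : Fin s → Bool) :
    hadamardMatrix s u (fun _ => false) = ((√(2 ^ s) : ℝ) : ℂ)⁻¹ := by
  simp only [hadamardMatrix, of_apply, Bool.and_false]
  simp only [Bool.false_eq_true, if_false, Finset.prod_const, Finset.card_univ, Fintype.card_fin]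
  have : √((2 : ℝ) ^ s) = √2 ^ s := by
    rw [Real.sqrt_eq_iff_mul_self_eq (by positivity) (by positivity), ← mul_pow,
      Real.mul_self_sqrt (by norm_num)]
  rw [this, one_div]
  push_cast
  rw [inv_pow]

lemma slice_phaseEstimation_of_zero (hr : IsReversible P π) (O : Subroutines P π x₀ d)
    (M : Finset X) {i : Fin k} {Ψ : Basis d k s → ℂ}
    (hΨ : ∀ a : Anc k s, a i ≠ (fun _ => false) → slice Ψ a = 0) (a : Anc k s) :
    slice (runCircuit O M (phaseEstimation i) Ψ) a =
      estimate (refl (projL P d) * refl (projR P d)) (a i)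
        (slice Ψ (Function.update a i fun _ => false)) := by
  rw [slice_phaseEstimation hr, estimate]
  refine Finset.sum_congr rfl fun u _ => ?_
  rw [Finset.sum_eq_single (fun _ => false), hadamardMatrix_apply_false]
  · intro v _ hv
    rw [hΨ _ (by simpa using hv), smul_zero]
  · simp

lemma runCircuit_estimations_fix (h : IsErgodicChain P) (hr : IsReversible P π)
    (hpos : ∀ x, 0 < π x) (O : Subroutines P π x₀ d) (M : Finset X) :
    runCircuit O M (estimations k s) (withZero k s (WithLp.toLp 2 (embR P d *ᵥ sqrtVec π))) =
      withZero k s (WithLp.toLp 2 (embR P d *ᵥ sqrtVec π)) := by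
  set x := (WithLp.toLp 2 (embR P d *ᵥ sqrtVec π) : EuclideanSpace ℂ (Item d × Item d)) with hx
  have hgap := isGapPair_emb h hr hpos O
  rw [← hx] at hgap
  have hone : ∀ i, runCircuit O M (phaseEstimation i) (withZero k s x) = withZero k s x := by
    intro i
    refine slice_ext fun a => ?_
    rw [slice_phaseEstimation_of_zero hr O M, slice_withZero, slice_withZero]
    · have hW := hgap.estimate_fix (a i)
      change estimate (refl (projL P d) * refl (projR P d)) (a i) x = _ at hW
      by_cases ha : Function.update a i (fun _ => false) = fun _ _ => false
      · rw [if_pos ha, hW]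
        have : (a i = fun _ => false) ↔ a = fun _ _ => false := by
          constructor
          · intro hi
            rw [← ha, ← hi, Function.update_eq_self]
          · rintro rfl; rfl
        simp only [this]
      · rw [if_neg ha, if_neg]
        · simp [estimate]
        · rintro rfl
          exact ha (by simp)
    · intro a ha
      rw [slice_withZero, if_neg]
      rintro rfl
      exact ha rfl
  rw [estimations]
  induction List.finRange k with
  | nil => rfl
  | cons i l ih => rw [List.flatMap_cons, runCircuit_append, hone, ih]

-- Induction over the estimated blocks. Slices remain in the walk space, so the one-block bound
-- applies again; blocks not yet estimated are still zero, as phase estimation requires of its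
-- input; and every estimation multiplies the weighted norm by at most 2.
open IsGapPair in
lemma sum_zeroWeight_slice_le (h : IsErgodicChain P) (hr : IsReversible P π)
    (hpos : ∀ x, 0 < π x) (O : Subroutines P π x₀ d) (M : Finset X)
    (hδ : 0 < eigenvalueGap P) (hδ1 : eigenvalueGap P ≤ 1) (hs : 8 ≤ 2 ^ s * √(eigenvalueGap P))
    {x : EuclideanSpace ℂ (Item d × Item d)} (hx : x ∈ (isGapPair_emb h hr hpos O).space)
    (l : List (Fin k)) (hl : l.Nodup) :
    (∀ a, slice (runCircuit O M (l.flatMap phaseEstimation) (withZero k s x)) a ∈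
      (isGapPair_emb h hr hpos O).space) ∧
    (∀ i, i ∉ l → ∀ a : Anc k s, a i ≠ (fun _ => false) →
      slice (runCircuit O M (l.flatMap phaseEstimation) (withZero k s x)) a = 0) ∧
    ∑ a, (l.map fun i => zeroWeight (a i)).prod *
      ‖slice (runCircuit O M (l.flatMap phaseEstimation) (withZero k s x)) a‖ ^ 2 ≤
        2 ^ l.length * ‖x‖ ^ 2 := by
  set hgap := isGapPair_emb h hr hpos O
  induction l using List.reverseRecOn with
  | nil =>
    have h0 : runCircuit O M (List.flatMap phaseEstimation []) (withZero k s x) =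
      withZero k s x := rfl
    simp only [h0, slice_withZero]
    refine ⟨fun a => ?_, fun i _ a ha => if_neg ?_, ?_⟩
    · split_ifs
      exacts [hx, zero_mem _]
    · rintro rfl; exact ha rfl
    · simp [apply_ite norm, ite_pow]
  | append_singleton l i ih =>
    rw [List.nodup_append] at hl
    have hil : i ∉ l := fun hi => hl.2.2 i hi i (by simp) rfl
    obtain ⟨ih1, ih2, ih3⟩ := ih hl.1
    rw [List.flatMap_append, List.flatMap_singleton, runCircuit_append]
    set Ψ := runCircuit O M (l.flatMap phaseEstimation) (withZero k s x)
    have hslice : ∀ a, slice (runCircuit O M (phaseEstimation i) Ψ) a = estimate hgap.walk (a i)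
        (slice Ψ (Function.update a i fun _ => false)) :=
      slice_phaseEstimation_of_zero hr O M (ih2 i hil)
    simp only [hslice]
    refine ⟨fun a => hgap.estimate_mem _ (ih1 _), fun j hj a ha => ?_, ?_⟩
    · rw [List.mem_append, List.mem_singleton, not_or] at hj
      rw [ih2 j hj.1]
      · simp [estimate]
      · rwa [Function.update_of_ne hj.2]
    · rw [sum_eq_sum_update i (fun _ => false)]
      -- 1 - (1 - δ)² = δ(2 - δ) ≥ δ because δ ≤ 1.
      have hc : eigenvalueGap P ≤ 1 - (1 - eigenvalueGap P) ^ 2 := by nlinarith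
      calc _ ≤ ∑ a : Anc k s, 2 * ((l.map fun i => zeroWeight (a i)).prod *
            ‖slice Ψ a‖ ^ 2) := by
            refine Finset.sum_le_sum fun a _ => ?_
            have hprod : 0 ≤ (l.map fun i => zeroWeight (a i)).prod :=
              List.prod_nonneg (by simp only [List.mem_map]; rintro _ ⟨j, -, rfl⟩
                                   exact zeroWeight_nonneg _)
            split_ifs with ha
            · have hterm : ∀ b, ((l ++ [i]).map fun j => zeroWeight
                  (Function.update a i b j)).prod * ‖estimate hgap.walk (Function.update a i b i)
                  (slice Ψ (Function.update (Function.update a i b) i fun _ => false))‖ ^ 2 =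
                  (l.map fun i => zeroWeight (a i)).prod *
                    (zeroWeight b * ‖estimate hgap.walk b (slice Ψ a)‖ ^ 2) := by
                intro b
                have h1 : (l.map fun j => zeroWeight (Function.update a i b j)) =
                    l.map fun j => zeroWeight (a j) :=
                  List.map_congr_left fun j hj => by
                    rw [Function.update_of_ne]; rintro rfl; exact hil hj
                rw [List.map_append, List.prod_append, h1, Function.update_idem, ← ha,
                  Function.update_eq_self]
                simp [mul_assoc]
              rw [Finset.sum_congr rfl fun b _ => hterm b, ← Finset.mul_sum]
              have := hgap.sum_zeroWeight_estimate_le hδ hc hs (ih1 a)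
              nlinarith
            · positivity
        _ ≤ _ := by
            rw [← Finset.mul_sum, List.length_append, List.length_singleton, pow_succ]
            linarith

open IsGapPair in
/-- On the part of the walk space orthogonal to the stationary state, the approximate reflection
is close to `-1`. -/
theorem norm_approxReflection_add_le (h : IsErgodicChain P) (hr : IsReversible P π)
    (hpos : ∀ x, 0 < π x) (O : Subroutines P π x₀ d) (M : Finset X)
    (hδ : 0 < eigenvalueGap P) (hδ1 : eigenvalueGap P ≤ 1) (hs : 8 ≤ 2 ^ s * √(eigenvalueGap P))
    {x : EuclideanSpace ℂ (Item d × Item d)} (hx : x ∈ (isGapPair_emb h hr hpos O).space) :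
    ‖WithLp.toLp 2 (runCircuit O M (approxReflection k s) (withZero k s x) + withZero k s x)‖ ≤
      2 / 2 ^ k * ‖x‖ := by
  set Φ := runCircuit O M (estimations k s) (withZero k s x) with hΦ
  -- Since R(P) = E⁻¹FE with E the estimations and F the median flip, R(P) + 1 = E⁻¹(F + 1)E, and F
  -- + 1 is twice the projection onto median zero.
  have h1 : runCircuit O M (approxReflection k s) (withZero k s x) + withZero k s x =
      runCircuit O M ((estimations k s).map invGate).reverse
        (gateMatrix O M .flipMedian *ᵥ Φ + Φ) := by
    rw [runCircuit_add, hΦ, estimations_inverse, approxReflection_eq, runCircuit_append,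
      runCircuit_append]
    rfl
  obtain ⟨-, -, h2⟩ := sum_zeroWeight_slice_le h hr hpos O M hδ hδ1 hs hx (List.finRange k)
    (List.nodup_finRange k)
  change ∑ a, _ * ‖slice Φ a‖ ^ 2 ≤ _ at h2
  rw [List.length_finRange] at h2
  rw [h1, norm_runCircuit, ← sq_le_sq₀ (norm_nonneg _) (by positivity), norm_sq_eq_sum_slice]
  -- A Markov-type bound: median zero forces at least k/2 zero blocks, so the weight there is at
  -- least 64^(k/2) = 8^k, against a total weighted norm of at most 2^k‖x‖².
  have hslice : ∀ a, ‖slice (gateMatrix O M .flipMedian *ᵥ Φ + Φ) a‖ ^ 2 ≤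
      4 / 8 ^ k * (((List.finRange k).map fun i => zeroWeight (a i)).prod * ‖slice Φ a‖ ^ 2) := by
    intro a
    have e1 : slice (gateMatrix O M .flipMedian *ᵥ Φ + Φ) a =
        (if median (fun i => blockVal (a i)) = 0 then (2 : ℂ) else 0) • slice Φ a := by
      ext z
      simp only [slice, gateMatrix, Pi.add_apply, mulVec_diagonal, WithLp.ofLp_smul, Pi.smul_apply,
        smul_eq_mul]
      split_ifs <;> ring
    have e2 : ((List.finRange k).map fun i => zeroWeight (a i)).prod =
        (64 : ℝ) ^ (Finset.univ.filter fun i => blockVal (a i) = 0).card := by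
      rw [← Fin.prod_univ_def]
      simp only [zeroWeight, blockVal_eq_zero]
      rw [Finset.prod_ite]
      simp
    rw [e1, e2, norm_smul, mul_pow]
    split_ifs with hm
    · have h3 : (8 : ℝ) ^ k ≤ 64 ^ (Finset.univ.filter fun i => blockVal (a i) = 0).card := by
        rw [show (64 : ℝ) = 8 ^ 2 by norm_num, ← pow_mul]
        exact pow_le_pow_right₀ (by norm_num) (le_two_mul_card_of_median_eq_zero hm)
      have h4 : (1 : ℝ) ≤ 64 ^ (Finset.univ.filter fun i => blockVal (a i) = 0).card / 8 ^ k := by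
        rwa [one_le_div (by positivity)]
      rw [Complex.norm_ofNat]
      calc (2 : ℝ) ^ 2 * ‖slice Φ a‖ ^ 2 = 4 * ‖slice Φ a‖ ^ 2 * 1 := by ring
        _ ≤ 4 * ‖slice Φ a‖ ^ 2 *
            (64 ^ (Finset.univ.filter fun i => blockVal (a i) = 0).card / 8 ^ k) := by gcongr
        _ = _ := by ring
    · rw [norm_zero, zero_pow two_ne_zero, zero_mul]
      positivity
  calc _ ≤ ∑ a, 4 / 8 ^ k * (((List.finRange k).map fun i => zeroWeight (a i)).prod *
          ‖slice Φ a‖ ^ 2) := Finset.sum_le_sum fun a _ => hslice a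
    _ ≤ 4 / 8 ^ k * (2 ^ k * ‖x‖ ^ 2) := by
        rw [← Finset.mul_sum]
        gcongr
    _ = (2 / 2 ^ k * ‖x‖) ^ 2 := by
        rw [show (8 : ℝ) = 2 * 2 * 2 by norm_num, mul_pow, mul_pow]
        field_simp
        ring

lemma approxReflection_fix (h : IsErgodicChain P) (hr : IsReversible P π)
    (hpos : ∀ x, 0 < π x) (O : Subroutines P π x₀ d) (M : Finset X) :
    runCircuit O M (approxReflection k s)
      (withZero k s (WithLp.toLp 2 (embR P d *ᵥ sqrtVec π))) =
      withZero k s (WithLp.toLp 2 (embR P d *ᵥ sqrtVec π)) := by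
  have hfix := runCircuit_estimations_fix (k := k) (s := s) h hr hpos O M
  have hinv := estimations_inverse O M (withZero k s (WithLp.toLp 2 (embR P d *ᵥ sqrtVec π)))
  rw [hfix] at hinv
  rw [approxReflection_eq, runCircuit_append, runCircuit_append, hfix]
  refine Eq.trans (congrArg _ ?_) hinv
  change gateMatrix O M .flipMedian *ᵥ _ = _
  funext b
  rw [gateMatrix, mulVec_diagonal]
  by_cases hb : b.2 = fun _ _ => false
  · simp [hb, blockVal_false, median_zero]
  · simp [withZero, hb]

end ApproxReflection

/-! ### Grover's rotation and the accumulated error of the search -/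

section Dynamics

variable {X D : Type*} [Fintype X] [DecidableEq X] {P : Matrix X X ℝ} {π : X → ℝ} {x₀ : X}
  {d : X → D} {k s : ℕ}

/-- The state `∑ x, α x |x⟩ ∑ y, √(P x y) |y⟩`, the ancilla being zero. -/
def lift (P : Matrix X X ℝ) (d : X → D) (k s : ℕ) (α : EuclideanSpace ℂ X) : Basis d k s → ℂ :=
  withZero k s ((embR P d).toEuclideanLin α)

lemma norm_lift (O : Subroutines P π x₀ d) (α : EuclideanSpace ℂ X) :
    ‖WithLp.toLp 2 (lift P d k s α)‖ = ‖α‖ := by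
  rw [lift, norm_withZero, norm_toEuclideanLin_of_isometry (embR_conjTranspose_mul_self O)]

lemma lift_apply (α : EuclideanSpace ℂ X) (b : Basis d k s) :
    lift P d k s α b = if b.2 = fun _ _ => false then
      ((√(P b.1.1.pt b.1.2.pt) : ℝ) : ℂ) * α b.1.1.pt else 0 := by
  rw [lift, withZero]
  congr 1
  exact embR_mulVec _ _

lemma lift_add (α β : EuclideanSpace ℂ X) :
    lift P d k s (α + β) = lift P d k s α + lift P d k s β := by
  rw [lift, map_add, withZero_add]; rfl

lemma lift_smul (z : ℂ) (α : EuclideanSpace ℂ X) :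
    lift P d k s (z • α) = z • lift P d k s α := by
  rw [lift, map_smul, withZero_smul]; rfl

/-- Multiply the amplitudes of the marked and of the unmarked states by `a` and `b`. -/
def scaleMarked (M : Finset X) (a b : ℂ) (α : EuclideanSpace ℂ X) : EuclideanSpace ℂ X :=
  WithLp.toLp 2 fun x => (if x ∈ M then a else b) * α x

lemma norm_sq_scaleMarked (M : Finset X) (a b : ℂ) (α : EuclideanSpace ℂ X) :
    ‖scaleMarked M a b α‖ ^ 2 =
      ‖a‖ ^ 2 * ∑ x ∈ M, ‖α x‖ ^ 2 + ‖b‖ ^ 2 * ∑ x ∈ Mᶜ, ‖α x‖ ^ 2 := by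
  rw [EuclideanSpace.norm_sq_eq, ← Finset.sum_add_sum_compl M, Finset.mul_sum, Finset.mul_sum]
  congr 1
  · refine Finset.sum_congr rfl fun x hx => ?_
    simp [scaleMarked, hx, mul_pow]
  · refine Finset.sum_congr rfl fun x hx => ?_
    rw [Finset.mem_compl] at hx
    simp [scaleMarked, hx, mul_pow]

lemma check_lift (O : Subroutines P π x₀ d) (M : Finset X) (α : EuclideanSpace ℂ X) :
    gateMatrix O M .check *ᵥ lift P d k s α = lift P d k s (scaleMarked M (-1) 1 α) := by
  funext b
  rw [gateMatrix, mulVec_diagonal, lift_apply, lift_apply]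
  simp only [scaleMarked]
  split_ifs <;> ring

/-- The superposition `∑ x, √(π x) |x⟩`. -/
def sqrtState (π : X → ℝ) : EuclideanSpace ℂ X := WithLp.toLp 2 (sqrtVec π)

omit [Fintype X] [DecidableEq X] in
lemma norm_sq_sqrtState_apply (hpos : ∀ x, 0 < π x) (x : X) : ‖sqrtState π x‖ ^ 2 = π x := by
  simp [sqrtState, sqrtVec, Real.sq_sqrt (hpos x).le]

omit [DecidableEq X] in
lemma norm_sqrtState (hπ : IsStationary P π) (hpos : ∀ x, 0 < π x) : ‖sqrtState π‖ = 1 := by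
  rw [← sq_eq_sq₀ (norm_nonneg _) zero_le_one, EuclideanSpace.norm_sq_eq,
    Finset.sum_congr rfl fun x _ => norm_sq_sqrtState_apply hpos x, hπ.sum_eq_one, one_pow]

lemma initial_eq (O : Subroutines P π x₀ d) (M : Finset X) :
    runCircuit O M [.setup, .updR]
      (Pi.single ((item d x₀, item d x₀), fun _ _ => false) 1 : Basis d k s → ℂ) =
      lift P d k s (sqrtState π) := by
  have h0 : (Pi.single ((item d x₀, item d x₀), fun _ _ => false) 1 : Basis d k s → ℂ) =
      withZero k s (WithLp.toLp 2 (Pi.single (item d x₀, item d x₀) 1)) := by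
    funext ⟨z, a⟩
    simp only [withZero, Pi.single_apply, Prod.mk.injEq]
    by_cases ha : a = fun _ _ => false <;> simp [ha]
  rw [h0]
  change (O.updR.1 ⊗ₖ 1) *ᵥ ((O.setup.1 ⊗ₖ 1) *ᵥ _) = _
  refine slice_ext fun a => ?_
  rw [slice_kronecker_one, slice_kronecker_one, slice_withZero, lift, slice_withZero]
  split_ifs
  · have hsetup : O.setup.1.toEuclideanLin
        (WithLp.toLp 2 (Pi.single (item d x₀, item d x₀) 1)) = WithLp.toLp 2
          (O.setup.1 *ᵥ Pi.single (item d x₀, item d x₀) 1) := rfl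
    rw [hsetup, O.setup_spec]
    have h1 : (fun z : Item d × Item d => if z.2 = item d x₀ then ((√(π z.1.pt) : ℝ) : ℂ) else 0) =
        (basisEmb fun x => (item d x, item d x₀)) *ᵥ sqrtVec π := by
      funext z
      rw [mulVec, dotProduct, Finset.sum_eq_single z.1.pt]
      · simp [basisEmb, sqrtVec, Prod.ext_iff, item_pt]
      · intro x _ hx
        have : z ≠ (item d x, item d x₀) := by
          rintro rfl; exact hx rfl
        simp [basisEmb, this]
      · simp
    rw [h1, toLpLin_toLp, toLin'_apply, mulVec_mulVec, ← O.embR_eq]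
    rfl
  · simp

/-- The reflection through the stationary superposition. -/
def reflectSqrt (π : X → ℝ) (α : EuclideanSpace ℂ X) : EuclideanSpace ℂ X :=
  (2 * inner ℂ (sqrtState π) α) • sqrtState π - α

/-- Split α into its component along √π, which R(P) fixes exactly, and an orthogonal rest β. The
lift of β is in the walk space, so it is almost negated. -/
lemma norm_approxReflection_lift_sub_le (h : IsErgodicChain P) (hπ : IsStationary P π)
    (hr : IsReversible P π) (O : Subroutines P π x₀ d) (M : Finset X)
    (hδ : 0 < eigenvalueGap P) (hδ1 : eigenvalueGap P ≤ 1) (hs : 8 ≤ 2 ^ s * √(eigenvalueGap P))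
    (α : EuclideanSpace ℂ X) :
    ‖WithLp.toLp 2 (runCircuit O M (approxReflection k s) (lift P d k s α) -
      lift P d k s (reflectSqrt π α))‖ ≤ 2 / 2 ^ k * ‖α‖ := by
  have hpos := hπ.pos h
  set v := sqrtState π with hv
  have hv1 : ‖v‖ = 1 := norm_sqrtState hπ hpos
  set c := inner ℂ v α with hc
  set β := α - c • v with hβ
  have hvv : inner ℂ v v = 1 := by rw [inner_self_eq_norm_sq_to_K, hv1]; simp
  have hvβ : inner ℂ v β = 0 := by rw [hβ, inner_sub_right, inner_smul_right, hvv]; simp [hc]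
  have hα : α = c • v + β := by rw [hβ]; abel
  have hfix : runCircuit O M (approxReflection k s) (lift P d k s v) = lift P d k s v :=
    approxReflection_fix h hr hpos O M
  have hmem : (embR P d).toEuclideanLin β ∈ (isGapPair_emb h hr hpos O).space := by
    refine Submodule.mem_sup_left ⟨?_, ?_⟩
    · change (embR P d * (embR P d)ᴴ).toEuclideanLin ((embR P d).toEuclideanLin β) = _
      rw [← LinearMap.comp_apply, ← toLpLin_mul, Matrix.mul_assoc, embR_conjTranspose_mul_self O,
        Matrix.mul_one]
      rfl
    · change inner ℂ ((embR P d).toEuclideanLin v) ((embR P d).toEuclideanLin β) = 0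
      rw [← LinearMap.adjoint_inner_right, ← toEuclideanLin_conjTranspose_eq_adjoint,
        ← LinearMap.comp_apply, ← toLpLin_mul, embR_conjTranspose_mul_self O, toLpLin_one,
        LinearMap.id_apply, hvβ]
  have hdiff : runCircuit O M (approxReflection k s) (lift P d k s α) -
      lift P d k s (reflectSqrt π α) =
      runCircuit O M (approxReflection k s) (lift P d k s β) + lift P d k s β := by
    have h1 : reflectSqrt π α = c • v + (-1 : ℂ) • β := by
      rw [reflectSqrt, ← hv, ← hc, hβ]; module
    rw [h1]
    nth_rewrite 1 [hα]
    rw [lift_add, lift_add, lift_smul, lift_smul, runCircuit_add, runCircuit_smul, hfix]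
    module
  have hβα : ‖β‖ ≤ ‖α‖ := by
    have horth : inner ℂ (c • v) β = 0 := by rw [inner_smul_left, hvβ, mul_zero]
    have h2 := norm_add_sq_eq_norm_sq_add_norm_sq_of_inner_eq_zero _ _ horth
    rw [← hα] at h2
    nlinarith [norm_nonneg α, norm_nonneg β, sq_nonneg ‖c • v‖]
  rw [hdiff]
  refine (norm_approxReflection_add_le h hr hpos O M hδ hδ1 hs hmem).trans ?_
  rw [norm_toEuclideanLin_of_isometry (embR_conjTranspose_mul_self O)]
  gcongr

/-- The state of the ideal search after `t` iterations. -/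
def groverState (π : X → ℝ) (M : Finset X) (θ : ℝ) (t : ℕ) : EuclideanSpace ℂ X :=
  scaleMarked M ((Real.sin ((2 * t + 1) * θ) / Real.sin θ : ℝ) : ℂ)
    ((Real.cos ((2 * t + 1) * θ) / Real.cos θ : ℝ) : ℂ) (sqrtState π)

lemma sum_compl_eq {M : Finset X} {θ : ℝ} (hπ : IsStationary P π)
    (hM : ∑ x ∈ M, π x = Real.sin θ ^ 2) : ∑ x ∈ Mᶜ, π x = Real.cos θ ^ 2 := by
  have h1 := Finset.sum_add_sum_compl M π
  rw [hπ.sum_eq_one, hM] at h1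
  linarith [Real.sin_sq_add_cos_sq θ]

/-- The unmarked states have total mass cos²θ, and every state has positive mass. So the quotient by
cos θ in `groverState` never matters when cos θ = 0. -/
lemma mem_of_cos_eq_zero {M : Finset X} {θ : ℝ} (hπ : IsStationary P π) (hpos : ∀ x, 0 < π x)
    (hM : ∑ x ∈ M, π x = Real.sin θ ^ 2) (hc : Real.cos θ = 0) (x : X) : x ∈ M := by
  by_contra hx
  have h1 := sum_compl_eq hπ hM
  have h2 := Finset.single_le_sum (fun y _ => hπ.nonneg y) (Finset.mem_compl.2 hx)
  rw [h1, hc] at h2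
  nlinarith [hpos x]

lemma groverState_zero {M : Finset X} {θ : ℝ} (hπ : IsStationary P π) (hpos : ∀ x, 0 < π x)
    (hM : ∑ x ∈ M, π x = Real.sin θ ^ 2) (hs : Real.sin θ ≠ 0) :
    groverState π M θ 0 = sqrtState π := by
  ext x
  simp only [groverState, scaleMarked, Nat.cast_zero, mul_zero, zero_add, one_mul, div_self hs]
  split_ifs with hx
  · simp
  · rw [div_self fun hc => hx (mem_of_cos_eq_zero hπ hpos hM hc x)]
    simp

/-- After the phase flip the overlap with √π is cos((2t+1)θ)cos θ - sin((2t+1)θ)sin θ =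
cos((2t+2)θ). Writing the old and new angles as (2t+2)θ ∓ θ, the addition formulas give the new
amplitudes. -/
lemma groverState_succ {M : Finset X} {θ : ℝ} (hπ : IsStationary P π) (hpos : ∀ x, 0 < π x)
    (hM : ∑ x ∈ M, π x = Real.sin θ ^ 2) (hs : Real.sin θ ≠ 0) (t : ℕ) :
    reflectSqrt π (scaleMarked M (-1) 1 (groverState π M θ t)) = groverState π M θ (t + 1) := by
  have hin : inner ℂ (sqrtState π) (scaleMarked M (-1) 1 (groverState π M θ t)) =
      ((Real.cos ((2 * t + 2) * θ) : ℝ) : ℂ) := by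
    have hr : inner ℂ (sqrtState π) (scaleMarked M (-1) 1 (groverState π M θ t)) =
        ((∑ x, (if x ∈ M then -(Real.sin ((2 * t + 1) * θ) / Real.sin θ) else
          Real.cos ((2 * t + 1) * θ) / Real.cos θ) * π x : ℝ) : ℂ) := by
      rw [PiLp.inner_apply]
      push_cast
      refine Finset.sum_congr rfl fun x _ => ?_
      have hx : ((√(π x) : ℝ) : ℂ) * ((√(π x) : ℝ) : ℂ) = π x := by
        rw [← Complex.ofReal_mul, Real.mul_self_sqrt (hpos x).le]
      simp only [groverState, scaleMarked, sqrtState, sqrtVec, RCLike.inner_apply,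
        Complex.conj_ofReal, ← hx]
      split_ifs <;> push_cast <;> ring
    rw [hr, ← Finset.sum_add_sum_compl M]
    congr 1
    rw [Finset.sum_congr rfl (g := fun x => -(Real.sin ((2 * t + 1) * θ) / Real.sin θ) * π x)
      fun x hx => by rw [if_pos hx], Finset.sum_congr (s₁ := Mᶜ) rfl
      (g := fun x => Real.cos ((2 * t + 1) * θ) / Real.cos θ * π x)
      fun x hx => by rw [if_neg (Finset.mem_compl.1 hx)], ← Finset.mul_sum, ← Finset.mul_sum, hM,
      sum_compl_eq hπ hM, show (2 * (t : ℝ) + 2) * θ = (2 * t + 1) * θ + θ by ring, Real.cos_add]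
    by_cases hc : Real.cos θ = 0
    · rw [hc]; field_simp; ring
    · field_simp; ring
  rw [reflectSqrt, hin]
  ext x
  simp only [groverState, scaleMarked, WithLp.ofLp_sub, WithLp.ofLp_smul, Pi.sub_apply,
    Pi.smul_apply, smul_eq_mul]
  have e1 : (2 * ((t + 1 : ℕ) : ℝ) + 1) * θ = (2 * t + 2) * θ + θ := by push_cast; ring
  have e2 : (2 * (t : ℝ) + 1) * θ = (2 * t + 2) * θ - θ := by ring
  rw [e1, e2]
  split_ifs with hx
  · rw [← mul_assoc, ← sub_mul]
    congr 1
    have : 2 * Real.cos ((2 * t + 2) * θ) - -1 * (Real.sin ((2 * t + 2) * θ - θ) / Real.sin θ) =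
        Real.sin ((2 * t + 2) * θ + θ) / Real.sin θ := by
      rw [Real.sin_add, Real.sin_sub]; field_simp; ring
    exact_mod_cast this
  · have hc : Real.cos θ ≠ 0 := fun hc => hx (mem_of_cos_eq_zero hπ hpos hM hc x)
    rw [← mul_assoc, ← sub_mul]
    congr 1
    have : 2 * Real.cos ((2 * t + 2) * θ) - 1 * (Real.cos ((2 * t + 2) * θ - θ) / Real.cos θ) =
        Real.cos ((2 * t + 2) * θ + θ) / Real.cos θ := by
      rw [Real.cos_add, Real.cos_sub]; field_simp; ring
    exact_mod_cast this

lemma norm_groverState_le {M : Finset X} {θ : ℝ} (hπ : IsStationary P π) (hpos : ∀ x, 0 < π x)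
    (hM : ∑ x ∈ M, π x = Real.sin θ ^ 2) (hs : Real.sin θ ≠ 0) (t : ℕ) :
    ‖groverState π M θ t‖ ≤ 1 := by
  rw [← sq_le_sq₀ (norm_nonneg _) zero_le_one, groverState, norm_sq_scaleMarked]
  simp only [norm_sq_sqrtState_apply hpos, hM, sum_compl_eq hπ hM, Complex.norm_real,
    Real.norm_eq_abs, sq_abs]
  have h1 := Real.sin_sq_add_cos_sq ((2 * t + 1) * θ)
  have h2 : (Real.sin ((2 * t + 1) * θ) / Real.sin θ) ^ 2 * Real.sin θ ^ 2 =
      Real.sin ((2 * t + 1) * θ) ^ 2 := by field_simp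
  have h3 : (Real.cos ((2 * t + 1) * θ) / Real.cos θ) ^ 2 * Real.cos θ ^ 2 ≤
      Real.cos ((2 * t + 1) * θ) ^ 2 := by
    by_cases hc : Real.cos θ = 0
    · rw [hc]; simp; positivity
    · apply le_of_eq; field_simp
  linarith

lemma norm_scaleMarked_neg_one (M : Finset X) (α : EuclideanSpace ℂ X) :
    ‖scaleMarked M (-1) 1 α‖ = ‖α‖ := by
  rw [← sq_eq_sq₀ (norm_nonneg _) (norm_nonneg _), norm_sq_scaleMarked, EuclideanSpace.norm_sq_eq,
    ← Finset.sum_add_sum_compl M]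
  simp

lemma finalState_zero (O : Subroutines P π x₀ d) (M : Finset X) :
    finalState O M k s 0 = lift P d k s (sqrtState π) := initial_eq O M

lemma finalState_succ (O : Subroutines P π x₀ d) (M : Finset X) (t : ℕ) :
    finalState O M k s (t + 1) =
      runCircuit O M (approxReflection k s) (gateMatrix O M .check *ᵥ finalState O M k s t) := by
  rw [finalState, finalState, searchCircuit, searchCircuit, List.replicate_succ', List.flatten_append,
    ← List.append_assoc, runCircuit_append, List.flatten_singleton, runCircuit_cons]

/-- The search stays close to the ideal search. -/
theorem norm_finalState_sub_le (h : IsErgodicChain P) (hπ : IsStationary P π)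
    (hr : IsReversible P π) (O : Subroutines P π x₀ d) {M : Finset X}
    (hδ : 0 < eigenvalueGap P) (hδ1 : eigenvalueGap P ≤ 1) (hs : 8 ≤ 2 ^ s * √(eigenvalueGap P))
    {θ : ℝ} (hM : ∑ x ∈ M, π x = Real.sin θ ^ 2) (hθ : Real.sin θ ≠ 0) (t : ℕ) :
    ‖WithLp.toLp 2 (finalState O M k s t - lift P d k s (groverState π M θ t))‖ ≤
      t * (2 / 2 ^ k) := by
  have hpos := hπ.pos h
  induction t with
  | zero => simp [finalState_zero, groverState_zero hπ hpos hM hθ]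
  | succ t ih =>
    set β := scaleMarked M (-1) 1 (groverState π M θ t) with hβ
    -- The old error is carried along unitarily; the only new error comes from one approximate
    -- reflection applied to an ideal state, which is a lift.
    have hsplit : finalState O M k s (t + 1) - lift P d k s (groverState π M θ (t + 1)) =
        runCircuit O M (approxReflection k s) (gateMatrix O M .check *ᵥ
          (finalState O M k s t - lift P d k s (groverState π M θ t))) +
        (runCircuit O M (approxReflection k s) (lift P d k s β) -
          lift P d k s (reflectSqrt π β)) := by
      rw [finalState_succ, mulVec_sub, runCircuit_sub, check_lift, hβ,
        groverState_succ hπ hpos hM hθ]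
      abel
    rw [hsplit, WithLp.toLp_add]
    refine (norm_add_le _ _).trans ?_
    rw [norm_runCircuit, norm_mulVec_of_mem_unitaryGroup (gateMatrix_mem_unitaryGroup O M _)]
    have h1 := norm_approxReflection_lift_sub_le (k := k) h hπ hr O M hδ hδ1 hs β
    have h2 : ‖β‖ ≤ 1 := by
      rw [hβ, norm_scaleMarked_neg_one]; exact norm_groverState_le hπ hpos hM hθ t
    have h3 : 2 / 2 ^ k * ‖β‖ ≤ 2 / 2 ^ k * 1 := by gcongr
    push_cast
    linarith

/-- The part of a state with a marked state in the left register. -/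
def markedPart (M : Finset X) (Ψ : Basis d k s → ℂ) : Basis d k s → ℂ :=
  fun b => if b.1.1.pt ∈ M then Ψ b else 0

lemma norm_markedPart_le (M : Finset X) (Ψ : Basis d k s → ℂ) :
    ‖WithLp.toLp 2 (markedPart M Ψ)‖ ≤ ‖WithLp.toLp 2 Ψ‖ := by
  rw [← sq_le_sq₀ (norm_nonneg _) (norm_nonneg _), EuclideanSpace.norm_sq_eq,
    EuclideanSpace.norm_sq_eq]
  refine Finset.sum_le_sum fun b _ => ?_
  simp only [markedPart]
  split_ifs
  · rfl
  · simp

lemma sum_searchProb (O : Subroutines P π x₀ d) (M : Finset X) (t : ℕ) :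
    ∑ x ∈ M, searchProb O M k s t (some x) =
      ‖WithLp.toLp 2 (markedPart M (finalState O M k s t))‖ ^ 2 := by
  rw [EuclideanSpace.norm_sq_eq]
  simp only [searchProb]
  rw [Finset.sum_comm]
  refine Finset.sum_congr rfl fun b _ => ?_
  simp only [markedPart, verdict]
  by_cases hb : b.1.1.pt ∈ M <;> simp [hb]

lemma norm_finalState (O : Subroutines P π x₀ d) (hπ : IsStationary P π) (hpos : ∀ x, 0 < π x)
    (M : Finset X) (t : ℕ) : ‖WithLp.toLp 2 (finalState O M k s t)‖ = 1 := by
  rw [finalState, searchCircuit, runCircuit_append, norm_runCircuit, initial_eq, norm_lift O,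
    norm_sqrtState hπ hpos]

lemma searchProb_none_add (O : Subroutines P π x₀ d) (hπ : IsStationary P π) (hpos : ∀ x, 0 < π x)
    (M : Finset X) (t : ℕ) :
    searchProb O M k s t none + ∑ x ∈ M, searchProb O M k s t (some x) = 1 := by
  have h1 := norm_finalState (k := k) (s := s) O hπ hpos M t
  rw [← one_pow 2, ← h1, EuclideanSpace.norm_sq_eq, sum_searchProb, EuclideanSpace.norm_sq_eq,
    searchProb, ← Finset.sum_add_distrib]
  refine Finset.sum_congr rfl fun b _ => ?_
  simp only [markedPart, verdict]
  by_cases hb : b.1.1.pt ∈ M <;> simp [hb]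

/-- The success probability of a run with `t` iterations. -/
theorem sum_searchProb_ge (h : IsErgodicChain P) (hπ : IsStationary P π)
    (hr : IsReversible P π) (O : Subroutines P π x₀ d) {M : Finset X}
    (hδ : 0 < eigenvalueGap P) (hδ1 : eigenvalueGap P ≤ 1) (hs : 8 ≤ 2 ^ s * √(eigenvalueGap P))
    {θ : ℝ} (hM : ∑ x ∈ M, π x = Real.sin θ ^ 2) (hθ : Real.sin θ ≠ 0) (t : ℕ) :
    Real.sin ((2 * t + 1) * θ) ^ 2 - 4 * t / 2 ^ k ≤
      ∑ x ∈ M, searchProb O M k s t (some x) := by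
  have hpos := hπ.pos h
  rw [sum_searchProb]
  set u := finalState O M k s t
  set w := lift P d k s (groverState π M θ t) with hw
  have hw2 : ‖WithLp.toLp 2 (markedPart M w)‖ ^ 2 = Real.sin ((2 * t + 1) * θ) ^ 2 := by
    have h1 : markedPart M w = lift P d k s (scaleMarked M 1 0 (groverState π M θ t)) := by
      funext b
      rw [markedPart, hw, lift_apply, lift_apply]
      simp only [scaleMarked]
      split_ifs <;> ring
    have h2 : scaleMarked M 1 0 (groverState π M θ t) =
        scaleMarked M ((Real.sin ((2 * t + 1) * θ) / Real.sin θ : ℝ) : ℂ) 0 (sqrtState π) := by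
      ext x
      simp only [groverState, scaleMarked]
      split_ifs <;> ring
    rw [h1, norm_lift O, h2, norm_sq_scaleMarked]
    simp only [norm_sq_sqrtState_apply hpos, hM, Complex.norm_real, Real.norm_eq_abs, sq_abs]
    field_simp
    simp
  have h1 : ‖WithLp.toLp 2 (markedPart M w)‖ ≤
      ‖WithLp.toLp 2 (markedPart M u)‖ + t * (2 / 2 ^ k) := by
    have h2 : markedPart M w = markedPart M u - markedPart M (u - w) := by
      funext b
      simp only [markedPart, Pi.sub_apply]
      split_ifs <;> ring
    rw [h2, WithLp.toLp_sub]
    refine (norm_sub_le _ _).trans ?_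
    gcongr
    exact (norm_markedPart_le M _).trans
      (norm_finalState_sub_le h hπ hr O hδ hδ1 hs hM hθ t)
  have h3 : ‖WithLp.toLp 2 (markedPart M w)‖ ≤ 1 := by
    rw [← sq_le_sq₀ (norm_nonneg _) zero_le_one, hw2, one_pow]
    exact Real.sin_sq_le_one _
  have h4 : 4 * (t : ℝ) / 2 ^ k = 2 * (t * (2 / 2 ^ k)) := by ring
  rw [h4, ← hw2]
  have h5 : (0 : ℝ) ≤ t * (2 / 2 ^ k) := by positivity
  have h7 := norm_nonneg (WithLp.toLp 2 (markedPart M w))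
  generalize ‖WithLp.toLp 2 (markedPart M w)‖ = a at *
  generalize ‖WithLp.toLp 2 (markedPart M u)‖ = b at *
  generalize (t : ℝ) * (2 / 2 ^ k) = e at *
  -- The goal is a² - 2e ≤ b², given a ≤ b + e and a ≤ 1. If a ≤ e the left side is not positive;
  -- otherwise (a - e)² ≥ a² - 2e.
  rcases le_total a e with hae | hae
  · nlinarith [sq_nonneg b, mul_nonneg h7 (sub_nonneg.2 h3)]
  · have h6 : (a - e) ^ 2 ≤ b ^ 2 := pow_le_pow_left₀ (by linarith) (by linarith) 2
    nlinarith [mul_nonneg h5 (sub_nonneg.2 h3), sq_nonneg e]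

end Dynamics

/-! ### Success of the ideal rotation for the best and for a random iteration count -/

section Trigonometry

/-- The number of iterations after which the ideal search is closest to its target. -/
def iterations (θ : ℝ) : ℕ := ⌊Real.pi / (4 * θ)⌋₊

/-- Above π/4 no iteration is made and sin²θ is the larger term. Otherwise the final angle is within
θ of π/2, so the failure probability is at most sin²θ. -/
lemma max_le_sin_sq_iterations {θ : ℝ} (h0 : 0 < θ) (h1 : θ ≤ Real.pi / 2) :
    max (Real.sin θ ^ 2) (1 - Real.sin θ ^ 2) ≤
      Real.sin ((2 * iterations θ + 1) * θ) ^ 2 := by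
  have hπ := Real.pi_pos
  by_cases hθ : Real.pi / 4 < θ
  · have hT : iterations θ = 0 := by
      rw [iterations, Nat.floor_eq_zero, div_lt_one (by linarith)]
      linarith
    have hcos : 1 - Real.sin θ ^ 2 ≤ Real.sin θ ^ 2 := by
      have h2 : Real.cos (2 * θ) ≤ 0 :=
        Real.cos_nonpos_of_pi_div_two_le_of_le (by linarith) (by linarith)
      rw [Real.cos_two_mul] at h2
      linarith [Real.sin_sq_add_cos_sq θ]
    rw [hT, max_eq_left hcos]
    simp
  · push Not at hθ
    have hcos : Real.sin θ ^ 2 ≤ 1 - Real.sin θ ^ 2 := by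
      have h2 : 0 ≤ Real.cos (2 * θ) :=
        Real.cos_nonneg_of_neg_pi_div_two_le_of_le (by linarith) (by linarith)
      rw [Real.cos_two_mul] at h2
      linarith [Real.sin_sq_add_cos_sq θ]
    rw [max_eq_right hcos]
    have hle : (iterations θ : ℝ) * (4 * θ) ≤ Real.pi := by
      rw [← le_div_iff₀ (by linarith)]
      exact Nat.floor_le (by positivity)
    have hlt : Real.pi < (iterations θ + 1 : ℝ) * (4 * θ) := by
      rw [← div_lt_iff₀ (by linarith)]
      exact Nat.lt_floor_add_one _
    set y := Real.pi / 2 - (2 * iterations θ + 1) * θ with hy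
    have hyabs : |y| ≤ θ := abs_le.2 ⟨by rw [hy]; linarith, by rw [hy]; linarith⟩
    have hcy : Real.cos ((2 * iterations θ + 1) * θ) ^ 2 = Real.sin |y| ^ 2 := by
      rcases abs_cases y with ⟨h, -⟩ | ⟨h, -⟩ <;> rw [h]
      · rw [hy, Real.sin_pi_div_two_sub]
      · rw [Real.sin_neg, neg_sq, hy, Real.sin_pi_div_two_sub]
    have hs : Real.sin |y| ≤ Real.sin θ := Real.sin_le_sin_of_le_of_le_pi_div_two
      (by linarith [abs_nonneg y]) h1 hyabs
    have hs0 : 0 ≤ Real.sin |y| := Real.sin_nonneg_of_nonneg_of_le_pi (abs_nonneg y) (by linarith)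
    have := pow_le_pow_left₀ hs0 hs 2
    rw [← hcy] at this
    linarith [Real.sin_sq_add_cos_sq ((2 * iterations θ + 1) * θ)]

lemma iterations_le {θ : ℝ} (h0 : 0 < θ) : (iterations θ : ℝ) ≤ 1 / θ := by
  refine (Nat.floor_le (by positivity)).trans ?_
  rw [div_le_div_iff₀ (by linarith) h0]
  nlinarith [Real.pi_le_four]

/-- Telescoping: 2 sin(2θ)cos((4t+2)θ) = sin(4(t+1)θ) - sin(4tθ). -/
lemma sin_two_mul_mul_sum_cos (θ : ℝ) (m : ℕ) :
    2 * Real.sin (2 * θ) * ∑ t ∈ range m, Real.cos ((4 * t + 2) * θ) = Real.sin (4 * m * θ) := by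
  induction m with
  | zero => simp
  | succ m ih =>
    rw [Finset.sum_range_succ, mul_add, ih]
    have e1 : (4 * (m : ℝ)) * θ = (4 * m + 2) * θ - 2 * θ := by ring
    have e2 : 4 * ((m + 1 : ℕ) : ℝ) * θ = (4 * m + 2) * θ + 2 * θ := by push_cast; ring
    rw [e1, e2, Real.sin_add, Real.sin_sub]
    ring

lemma sum_cos_le_of_le_sin {θ : ℝ} {m : ℕ} (hm : 0 < m) (h : 1 / m ≤ Real.sin (2 * θ)) :
    ∑ t ∈ range m, Real.cos ((4 * t + 2) * θ) ≤ m / 2 := by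
  have h1 := sin_two_mul_mul_sum_cos θ m
  have h2 := Real.sin_le_one (4 * m * θ)
  have hm' : (0 : ℝ) < m := by exact_mod_cast hm
  by_contra hcon
  push Not at hcon
  have h3 : 2 * (1 / m) * (m / 2 : ℝ) < 2 * Real.sin (2 * θ) *
      ∑ t ∈ range m, Real.cos ((4 * t + 2) * θ) := by
    have h4 : (0 : ℝ) < 2 * (1 / m) := by positivity
    exact mul_lt_mul' (by linarith) hcon (by positivity) (by linarith)
  rw [h1] at h3
  have h5 : 2 * (1 / m) * (m / 2 : ℝ) = 1 := by field_simp
  linarith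

/-- For θ ≤ π/4, sin 2θ ≥ sin θ ≥ 1/m and the telescoped sum suffices. Near π/2, where sin 2θ may be
too small, put φ = π/2 - θ: either 4mφ > π and Jordan's inequality gives sin 2φ ≥ 1/m, or 4mφ ≤ π
and the sum is at most 0, being minus the corresponding sum for φ. -/
lemma sum_cos_le {θ : ℝ} (h0 : 0 < θ) (h1 : θ ≤ Real.pi / 2) {m : ℕ} (hm : 0 < m)
    (hθ : 1 / m ≤ Real.sin θ) : ∑ t ∈ range m, Real.cos ((4 * t + 2) * θ) ≤ m / 2 := by
  have hπ := Real.pi_pos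
  have hm' : (0 : ℝ) < m := by exact_mod_cast hm
  by_cases hθ4 : θ ≤ Real.pi / 4
  · refine sum_cos_le_of_le_sin hm (hθ.trans ?_)
    have hc : 1 / 2 ≤ Real.cos θ := by
      rw [← Real.cos_pi_div_three]
      exact Real.cos_le_cos_of_nonneg_of_le_pi h0.le (by linarith) (by linarith)
    have hs : 0 ≤ Real.sin θ := Real.sin_nonneg_of_nonneg_of_le_pi h0.le (by linarith)
    rw [Real.sin_two_mul]
    nlinarith
  · push Not at hθ4
    set φ := Real.pi / 2 - θ with hφ
    have hφ0 : 0 ≤ φ := by rw [hφ]; linarith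
    have hsin : Real.sin (2 * θ) = Real.sin (2 * φ) := by
      rw [← Real.sin_pi_sub]
      congr 1
      rw [hφ]; ring
    by_cases hbig : Real.pi < 4 * m * φ
    · refine sum_cos_le_of_le_sin hm ?_
      rw [hsin]
      have h2 := Real.mul_le_sin (x := 2 * φ) (by linarith) (by linarith)
      refine le_trans ?_ h2
      rw [div_le_iff₀ hm', div_mul_eq_mul_div, div_mul_eq_mul_div, le_div_iff₀ hπ]
      nlinarith
    · push Not at hbig
      have hsum : ∑ t ∈ range m, Real.cos ((4 * t + 2) * θ) =
          -∑ t ∈ range m, Real.cos ((4 * t + 2) * φ) := by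
        rw [← Finset.sum_neg_distrib]
        refine Finset.sum_congr rfl fun t _ => ?_
        have e : (4 * (t : ℝ) + 2) * θ = Real.pi - (4 * t + 2) * φ + t * (2 * Real.pi) := by
          rw [hφ]; ring
        rw [e, Real.cos_add_nat_mul_two_pi, Real.cos_pi_sub]
      rw [hsum]
      rcases hφ0.eq_or_lt with hφz | hφp
      · rw [← hφz]
        simp
        linarith
      · have h3 := sin_two_mul_mul_sum_cos φ m
        have h4 : 0 ≤ Real.sin (4 * m * φ) :=
          Real.sin_nonneg_of_nonneg_of_le_pi (by positivity) hbig
        have h5 : 0 < Real.sin (2 * φ) :=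
          Real.sin_pos_of_pos_of_lt_pi (by linarith) (by linarith)
        rw [← h3] at h4
        have h6 := nonneg_of_mul_nonneg_right h4 (by linarith)
        linarith

lemma sum_sin_sq_ge {θ : ℝ} (h0 : 0 < θ) (h1 : θ ≤ Real.pi / 2) {m : ℕ} (hm : 0 < m)
    (hθ : 1 / m ≤ Real.sin θ) : (m : ℝ) / 4 ≤ ∑ t ∈ range m, Real.sin ((2 * t + 1) * θ) ^ 2 := by
  have h : ∀ t : ℕ, Real.sin ((2 * t + 1) * θ) ^ 2 =
      1 / 2 - Real.cos ((4 * t + 2) * θ) / 2 := by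
    intro t
    rw [Real.sin_sq_eq_half_sub]
    congr 3
    ring
  simp only [h, Finset.sum_sub_distrib, ← Finset.sum_div]
  have := sum_cos_le h0 h1 hm hθ
  simp only [Finset.sum_const, card_range, nsmul_eq_mul]
  linarith

end Trigonometry

/-! ### Amplification by independent runs -/

section Repetition

variable {X : Type*}

lemma repeatProb_none (q : Option X → ℝ) (r : ℕ) : repeatProb q r none = q none ^ r := by
  induction r with
  | zero => simp [repeatProb]
  | succ r ih => simp [repeatProb, ih, pow_succ']

lemma sum_repeatProb {M : Finset X} {q : Option X → ℝ}
    (hq : q none + ∑ x ∈ M, q (some x) = 1) (r : ℕ) :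
    ∑ x ∈ M, repeatProb q r (some x) = 1 - q none ^ r := by
  induction r with
  | zero => simp [repeatProb]
  | succ r ih =>
    simp only [repeatProb, reduceCtorEq, if_false, Finset.sum_add_distrib, ← Finset.mul_sum, ih]
    rw [pow_succ']
    linarith

lemma findsMarked_repeatProb {M : Finset X} {q : Option X → ℝ} {c η : ℝ} {r : ℕ}
    (hnone : 0 ≤ q none) (hq : q none + ∑ x ∈ M, q (some x) = 1)
    (hc : M.Nonempty → c ≤ ∑ x ∈ M, q (some x)) (hr : (1 - c) ^ r ≤ η) :
    FindsMarked M (repeatProb q r) (1 - η) := by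
  constructor
  · rintro rfl
    rw [repeatProb_none]
    rw [Finset.sum_empty, add_zero] at hq
    rw [hq, one_pow]
  · intro hM
    rw [sum_repeatProb hq]
    have h1 : q none ≤ 1 - c := by linarith [hc hM]
    linarith [pow_le_pow_left₀ hnone h1 r]

end Repetition

/-! ### Gate counting -/

section Costs

variable {k s : ℕ}

lemma circuitCost_append (S U C : ℝ) (c c' : Circuit k s) :
    circuitCost S U C (c ++ c') = circuitCost S U C c + circuitCost S U C c' := by
  simp [circuitCost]

lemma circuitCost_flatten_replicate (S U C : ℝ) (n : ℕ) (c : Circuit k s) :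
    circuitCost S U C (List.replicate n c).flatten = n * circuitCost S U C c := by
  induction n with
  | zero => simp [circuitCost]
  | succ n ih =>
    rw [List.replicate_succ, List.flatten_cons, circuitCost_append, ih]
    push_cast
    ring

lemma circuitCost_flatMap {ι : Type*} (S U C : ℝ) (l : List ι) (f : ι → Circuit k s) :
    circuitCost S U C (l.flatMap f) = (l.map fun i => circuitCost S U C (f i)).sum := by
  induction l with
  | nil => simp [circuitCost]
  | cons i l ih => rw [List.flatMap_cons, circuitCost_append, ih, List.map_cons, List.sum_cons]

lemma circuitCost_cons (S U C : ℝ) (g : Gate k s) (c : Circuit k s) :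
    circuitCost S U C (g :: c) = gateCost S U C g + circuitCost S U C c := by
  simp [circuitCost]

lemma sum_two_pow_finRange (s : ℕ) (c : ℝ) :
    ((List.finRange s).map fun j : Fin s => ((2 ^ (j : ℕ) : ℕ) : ℝ) * c).sum =
      (2 ^ s - 1) * c := by
  rw [← Fin.sum_univ_def, Fin.sum_univ_eq_sum_range fun j => ((2 ^ j : ℕ) : ℝ) * c,
    ← Finset.sum_mul]
  push_cast
  rw [geom_sum_eq (by norm_num)]
  norm_num

/-- The walk is applied 1 + 2 + ⋯ + 2^(s-1) times, with four updates each. -/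
lemma circuitCost_phaseEstimation (S U C : ℝ) (i : Fin k) :
    circuitCost S U C (phaseEstimation (s := s) i) = (2 ^ s - 1) * (4 * U) := by
  have h1 : ∀ j : Fin s, circuitCost S U C (ctrlWalk i j) = 4 * U := by
    intro j
    simp [circuitCost, ctrlWalk, gateCost]
    ring
  rw [phaseEstimation, circuitCost_append, circuitCost_append, circuitCost_flatMap]
  simp only [circuitCost_flatten_replicate, h1]
  rw [sum_two_pow_finRange]
  simp [circuitCost, gateCost]

lemma circuitCost_phaseEstimationInv (S U C : ℝ) (i : Fin k) :
    circuitCost S U C (phaseEstimationInv (s := s) i) = (2 ^ s - 1) * (4 * U) := by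
  rw [phaseEstimationInv_eq, ← circuitCost_phaseEstimation S U C i, circuitCost, circuitCost,
    List.map_reverse, List.sum_reverse, List.map_map]
  congr 2
  funext g
  cases g <;> rfl

lemma circuitCost_approxReflection (S U C : ℝ) (k s : ℕ) :
    circuitCost S U C (approxReflection k s) = 8 * k * (2 ^ s - 1) * U := by
  rw [approxReflection, circuitCost_append, circuitCost_append, circuitCost_flatMap,
    circuitCost_flatMap]
  simp only [circuitCost_phaseEstimation, circuitCost_phaseEstimationInv]
  simp [circuitCost, gateCost]
  ring

lemma runCost_eq (S U C : ℝ) (k s t : ℕ) :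
    runCost S U C k s t = S + U + t * (C + 8 * k * (2 ^ s - 1) * U) + C := by
  rw [runCost, searchCircuit, circuitCost_append, circuitCost_flatten_replicate,
    circuitCost_cons _ _ _ Gate.check, circuitCost_approxReflection]
  simp [circuitCost, gateCost]

end Costs

/-! ### Bounds for the parameters and for the randomized run -/

section Parameters

/-- The 8 makes the amplitude of a false zero at most 1/8; rounding up to a power of two costs a
factor of at most 2. -/
lemma exists_two_pow_between {δ : ℝ} (h0 : 0 < δ) (h1 : δ ≤ 1) :
    ∃ s : ℕ, 8 ≤ 2 ^ s * √δ ∧ (2 : ℝ) ^ s ≤ 16 / √δ := by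
  have hs := Real.sqrt_pos.2 h0
  have hs1 : √δ ≤ 1 := Real.sqrt_le_one.2 h1
  obtain ⟨n, hn1, hn2⟩ := exists_nat_pow_near (x := 8 / √δ) (y := 2)
    (by rw [one_le_div hs]; linarith) (by norm_num)
  refine ⟨n + 1, ?_, ?_⟩
  · rw [div_lt_iff₀ hs] at hn2
    exact hn2.le
  · rw [pow_succ]
    calc (2 : ℝ) ^ n * 2 ≤ 8 / √δ * 2 := by gcongr
      _ = 16 / √δ := by ring

lemma exp_le_two_pow_ceil {x : ℝ} : Real.exp x ≤ 2 ^ ⌈2 * x⌉₊ := by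
  have h2 : (2 : ℝ) ^ ⌈2 * x⌉₊ = Real.exp (⌈2 * x⌉₊ * Real.log 2) := by
    rw [Real.exp_nat_mul, Real.exp_log (by norm_num)]
  rw [h2, Real.exp_le_exp]
  have h3 := Nat.le_ceil (2 * x)
  have h4 : (0 : ℝ) ≤ ⌈2 * x⌉₊ := Nat.cast_nonneg _
  nlinarith [Real.log_two_gt_d9]

/-- Here a = 1/√ε, b = 1/√δ and L = 1 + log(1/√ε). The constant 256 is 2 · 8 · 16, from the bounds
on t, the reflection cost and 2^s; the 3 absorbs the initial update and the checks 2aC + C. -/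
lemma runCost_le {S U C a b L κ : ℝ} {k s t : ℕ} (hS : 0 ≤ S) (hU : 0 ≤ U) (hC : 0 ≤ C)
    (ha : 1 ≤ a) (hb : 1 ≤ b) (hL : 1 ≤ L) (hκ : 0 ≤ κ) (hk : (k : ℝ) ≤ κ * L)
    (hs : (2 : ℝ) ^ s ≤ 16 * b) (ht : (t : ℝ) ≤ 2 * a) :
    runCost S U C k s t ≤ (256 * κ + 3) * (S + a * (b * L * U + C)) := by
  rw [runCost_eq]
  have hs1 : (1 : ℝ) ≤ 2 ^ s := one_le_pow₀ (by norm_num)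
  have h1 : 8 * (k : ℝ) * (2 ^ s - 1) ≤ 8 * (κ * L) * (16 * b) := by
    gcongr
    linarith
  have h2 : (t : ℝ) * (C + 8 * k * (2 ^ s - 1) * U) ≤
      2 * a * (C + 8 * (κ * L) * (16 * b) * U) := by
    have h3 : 8 * (k : ℝ) * (2 ^ s - 1) * U ≤ 8 * (κ * L) * (16 * b) * U := by gcongr
    have h4 : 0 ≤ 8 * (k : ℝ) * (2 ^ s - 1) * U :=
      mul_nonneg (mul_nonneg (by positivity) (by linarith)) hU
    have h5 : C + 8 * (k : ℝ) * (2 ^ s - 1) * U ≤ C + 8 * (κ * L) * (16 * b) * U := by linarith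
    exact mul_le_mul ht h5 (by linarith) (by linarith)
  have h6 : U ≤ a * (b * L * U) := by
    have : 1 ≤ a * (b * L) := one_le_mul_of_one_le_of_one_le ha
      (one_le_mul_of_one_le_of_one_le hb hL)
    nlinarith
  have h7 : C ≤ a * C := by nlinarith
  have h8 : 0 ≤ κ * S := mul_nonneg hκ hS
  have h9 : 0 ≤ κ * (a * C) := mul_nonneg hκ (by linarith)
  nlinarith

lemma sqrt_le_arcsin_sqrt {ε p : ℝ} (h1 : ε ≤ 1) (hp : ε ≤ p) :
    √ε ≤ Real.arcsin √p := by
  have hs1 : √ε ≤ 1 := Real.sqrt_le_one.2 h1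
  have hs0 : 0 ≤ √ε := Real.sqrt_nonneg ε
  calc √ε = Real.sin (Real.arcsin √ε) := (Real.sin_arcsin (by linarith) hs1).symm
    _ ≤ Real.arcsin √ε := Real.sin_le (Real.arcsin_nonneg.2 hs0)
    _ ≤ _ := Real.monotone_arcsin (Real.sqrt_le_sqrt hp)

variable {X D : Type*} [Fintype X] [DecidableEq X] {P : Matrix X X ℝ} {π : X → ℝ} {x₀ : X}
  {d : X → D} {k s : ℕ}

lemma searchProb_nonneg (O : Subroutines P π x₀ d) (M : Finset X) (t : ℕ) (o : Option X) :
    0 ≤ searchProb O M k s t o :=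
  Finset.sum_nonneg fun _ _ => by split_ifs <;> positivity

lemma sum_randomSearchProb (O : Subroutines P π x₀ d) (M : Finset X) (m : ℕ) :
    ∑ x ∈ M, randomSearchProb O M k s m (some x) =
      (∑ t ∈ range m, ∑ x ∈ M, searchProb O M k s t (some x)) / m := by
  simp only [randomSearchProb]
  rw [← Finset.sum_div, Finset.sum_comm]

lemma randomSearchProb_none_add (O : Subroutines P π x₀ d) (hπ : IsStationary P π)
    (hpos : ∀ x, 0 < π x) (M : Finset X) {m : ℕ} (hm : 0 < m) :
    randomSearchProb O M k s m none + ∑ x ∈ M, randomSearchProb O M k s m (some x) = 1 := by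
  rw [sum_randomSearchProb, randomSearchProb, ← add_div, ← Finset.sum_add_distrib,
    Finset.sum_congr rfl fun t _ => searchProb_none_add O hπ hpos M t]
  have : (m : ℝ) ≠ 0 := by exact_mod_cast hm.ne'
  simp [this]

end Parameters

end QuantumSearch

end

/-! ### Choice of the parameters and conclusion -/

open QuantumSearch in
theorem mainTheorem5 (η : ℝ) (hη : 0 < η) :
    ∃ (K : ℝ) (r : ℕ), ∀ ε δ : ℝ, 0 < ε → ε ≤ 1 → 0 < δ → δ ≤ 1 →
      ∃ (k s m : ℕ) (T : ℝ → ℕ),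
        -- the parameters of the procedure
        (k : ℝ) ≤ K * (1 + Real.log (1 / √ε)) ∧ (2 : ℝ) ^ s ≤ K / √δ ∧
        (m : ℝ) ≤ K / √ε ∧ (∀ p, (T p : ℝ) ≤ K / √ε) ∧
        -- the cost of one run, of `r` runs, and of `r` runs with random numbers of iterations
        (∀ S U C : ℝ, 0 ≤ S → 0 ≤ U → 0 ≤ C →
          (∀ p, QuantumSearch.runCost S U C k s (T p) ≤
            K * QuantumSearch.targetCost S U C ε δ) ∧
          (∀ p, r * QuantumSearch.runCost S U C k s (T p) ≤
            K * QuantumSearch.targetCost S U C ε δ) ∧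
          (∀ t : Fin r → ℕ, (∀ i, t i < m) →
            ∑ i, QuantumSearch.runCost S U C k s (t i) ≤
              K * QuantumSearch.targetCost S U C ε δ)) ∧
        -- correctness
        ∀ (X : Type*) [Fintype X] [DecidableEq X] (P : Matrix X X ℝ) (π : X → ℝ),
          QuantumSearch.IsErgodicChain P → QuantumSearch.IsStationary P π →
          QuantumSearch.IsReversible P π → QuantumSearch.eigenvalueGap P = δ →
          ∀ (x₀ : X) (D : Type*) (d : X → D) (O : QuantumSearch.Subroutines P π x₀ d)
            (M : Finset X), (M.Nonempty → ε ≤ ∑ x ∈ M, π x) →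
            -- the marked probability, if not zero, is known to be `p`
            (∀ p : ℝ, (M.Nonempty → ∑ x ∈ M, π x = p) →
              QuantumSearch.FindsMarked M (QuantumSearch.searchProb O M k s (T p))
                (max p (1 - p) - η) ∧
              QuantumSearch.FindsMarked M
                (QuantumSearch.repeatProb (QuantumSearch.searchProb O M k s (T p)) r)
                (1 - η)) ∧
            -- only the lower bound `ε` is known
            QuantumSearch.FindsMarked M
              (QuantumSearch.repeatProb (QuantumSearch.randomSearchProb O M k s m) r)
              (1 - η) := by
  -- Errors of at most 1/8 keep the success probability of one run at least 1/8 in both variants: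
  -- 1/2 - 1/8 for known p, 1/4 - 1/8 for random t.
  set η' := min η (1 / 8) with hη'
  have hη'0 : 0 < η' := lt_min hη (by norm_num)
  have hη'η : η' ≤ η := min_le_left _ _
  have hη'8 : η' ≤ 1 / 8 := min_le_right _ _
  obtain ⟨r, hr⟩ := exists_pow_lt_of_lt_one hη (show (7 / 8 : ℝ) < 1 by norm_num)
  have hrη : (1 - 1 / 8 : ℝ) ^ r ≤ η := by
    rw [show (1 - 1 / 8 : ℝ) = 7 / 8 by norm_num]; exact hr.le
  have hlog : 0 ≤ Real.log (8 / η') := Real.log_nonneg (by rw [one_le_div hη'0]; linarith)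
  set κ := 2 * Real.log (8 / η') + 3 with hκ
  have hκ0 : 3 ≤ κ := by rw [hκ]; linarith
  have hr0 : (0 : ℝ) ≤ r := Nat.cast_nonneg r
  -- The factor r + 1 lets one constant serve a single run and r runs, also when r = 0.
  have hK : 256 * κ + 3 ≤ (r + 1) * (256 * κ + 3) := by nlinarith
  refine ⟨(r + 1) * (256 * κ + 3), r, fun ε δ hε hε1 hδ hδ1 => ?_⟩
  have hsε := Real.sqrt_pos.2 hε
  have hsδ := Real.sqrt_pos.2 hδ
  have hsε1 : √ε ≤ 1 := Real.sqrt_le_one.2 hε1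
  have hsδ1 : √δ ≤ 1 := Real.sqrt_le_one.2 hδ1
  have ha : 1 ≤ 1 / √ε := by rwa [one_le_div hsε]
  have hb : 1 ≤ 1 / √δ := by rwa [one_le_div hsδ]
  have hL : 0 ≤ Real.log (1 / √ε) := Real.log_nonneg ha
  obtain ⟨s, hs8, hs16⟩ := exists_two_pow_between hδ hδ1
  -- Chosen so that 2^k ≥ 8/(η'√ε), since 2 log 2 > 1; then 4t/2^k ≤ η' for every t ≤ 2/√ε.
  set k := ⌈2 * (Real.log (8 / η') + Real.log (1 / √ε))⌉₊ with hkdef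
  have hk : (k : ℝ) ≤ κ * (1 + Real.log (1 / √ε)) := by
    have h1 := Nat.ceil_lt_add_one
      (show 0 ≤ 2 * (Real.log (8 / η') + Real.log (1 / √ε)) by positivity)
    rw [← hkdef] at h1
    nlinarith
  have h2k : 8 / η' * (1 / √ε) ≤ 2 ^ k := by
    refine le_trans (le_of_eq ?_) exp_le_two_pow_ceil
    rw [Real.exp_add, Real.exp_log (by positivity), Real.exp_log (by positivity)]
  have herr : ∀ t : ℕ, (t : ℝ) ≤ 2 * (1 / √ε) → 4 * (t : ℝ) / 2 ^ k ≤ η' := by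
    intro t ht
    rw [div_le_iff₀ (by positivity)]
    have h3 := mul_le_mul_of_nonneg_left h2k hη'0.le
    have h4 : η' * (8 / η' * (1 / √ε)) = 8 * (1 / √ε) := by field_simp
    linarith
  set m := ⌈1 / √ε⌉₊ with hmdef
  have hm1 : 1 / √ε ≤ m := Nat.le_ceil _
  have hm2 : (m : ℝ) ≤ 2 * (1 / √ε) := by
    have := Nat.ceil_lt_add_one (show 0 ≤ 1 / √ε by positivity)
    rw [← hmdef] at this
    linarith
  have hm0 : 0 < m := by
    have : (0 : ℝ) < m := by linarith
    exact_mod_cast this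
  -- The bound is required for every real p. Values below ε can only occur when nothing is marked,
  -- so the default 0 is harmless there.
  have hT : ∀ p, ((if ε ≤ p then iterations (Real.arcsin √p) else 0 : ℕ) : ℝ) ≤ 1 / √ε := by
    intro p
    split_ifs with hp
    · have h1 := sqrt_le_arcsin_sqrt hε1 hp
      exact (iterations_le (by linarith)).trans (one_div_le_one_div_of_le hsε h1)
    · simp
  have hcost : ∀ S U C : ℝ, 0 ≤ S → 0 ≤ U → 0 ≤ C → ∀ t : ℕ, (t : ℝ) ≤ 2 * (1 / √ε) →
      runCost S U C k s t ≤ (256 * κ + 3) * targetCost S U C ε δ := by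
    intro S U C hS hU hC t ht
    exact runCost_le hS hU hC ha hb (by linarith) (by linarith) hk
      (hs16.trans (le_of_eq (by ring))) ht
  have htarget : ∀ S U C : ℝ, 0 ≤ S → 0 ≤ U → 0 ≤ C → 0 ≤ targetCost S U C ε δ := by
    intro S U C hS hU hC
    unfold targetCost
    positivity
  have hKtarget : ∀ S U C : ℝ, 0 ≤ S → 0 ≤ U → 0 ≤ C →
      (256 * κ + 3) * targetCost S U C ε δ ≤
        (r + 1) * (256 * κ + 3) * targetCost S U C ε δ ∧
      r * ((256 * κ + 3) * targetCost S U C ε δ) ≤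
        (r + 1) * (256 * κ + 3) * targetCost S U C ε δ := by
    intro S U C hS hU hC
    have h1 := htarget S U C hS hU hC
    have h2 : 0 ≤ (256 * κ + 3) * targetCost S U C ε δ := mul_nonneg (by linarith) h1
    constructor <;> nlinarith
  refine ⟨k, s, m, fun p => if ε ≤ p then iterations (Real.arcsin √p) else 0, ?_, ?_, ?_, ?_,
    fun S U C hS hU hC => ⟨fun p => ?_, fun p => ?_, fun t ht => ?_⟩, ?_⟩
  · exact hk.trans (mul_le_mul_of_nonneg_right (by linarith) (by linarith))
  · exact hs16.trans (div_le_div_of_nonneg_right (by linarith) hsδ.le)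
  · refine hm2.trans ?_
    rw [mul_one_div]
    exact div_le_div_of_nonneg_right (by linarith) hsε.le
  · exact fun p => (hT p).trans (div_le_div_of_nonneg_right (by linarith) hsε.le)
  · exact (hcost S U C hS hU hC _ ((hT p).trans (by linarith))).trans (hKtarget S U C hS hU hC).1
  · exact (mul_le_mul_of_nonneg_left (hcost S U C hS hU hC _ ((hT p).trans (by linarith)))
      hr0).trans (hKtarget S U C hS hU hC).2
  · have h1 : ∀ i, runCost S U C k s (t i) ≤ (256 * κ + 3) * targetCost S U C ε δ := by
      intro i
      refine hcost S U C hS hU hC _ (le_trans ?_ hm2)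
      exact_mod_cast (ht i).le
    refine (Finset.sum_le_sum fun i _ => h1 i).trans ?_
    rw [Finset.sum_const, Finset.card_univ, Fintype.card_fin, nsmul_eq_mul]
    exact (hKtarget S U C hS hU hC).2
  intro X _ _ P π hP hπ hrev hgap x₀ D d O M hMε
  subst hgap
  have hpos := hπ.pos hP
  have hsum := fun t => searchProb_none_add (k := k) (s := s) O hπ hpos M t
  have hgeom : M.Nonempty → ∃ θ, θ = Real.arcsin √(∑ x ∈ M, π x) ∧ 0 < θ ∧ θ ≤ Real.pi / 2 ∧
      √ε ≤ Real.sin θ ∧ ∑ x ∈ M, π x = Real.sin θ ^ 2 := by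
    intro hM
    have hp1 : ∑ x ∈ M, π x ≤ 1 := by
      rw [← hπ.sum_eq_one]
      exact Finset.sum_le_univ_sum_of_nonneg hπ.nonneg
    have h1 := Real.sqrt_nonneg (∑ x ∈ M, π x)
    have hsin := Real.sin_arcsin (by linarith) (Real.sqrt_le_one.2 hp1)
    refine ⟨_, rfl, hsε.trans_le (sqrt_le_arcsin_sqrt hε1 (hMε hM)), Real.arcsin_le_pi_div_two _,
      ?_, ?_⟩
    · rw [hsin]; exact Real.sqrt_le_sqrt (hMε hM)
    · rw [hsin, Real.sq_sqrt (hε.le.trans (hMε hM))]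
  refine ⟨fun p hp => ?_, ?_⟩
  · have hsucc : M.Nonempty → max p (1 - p) - η' ≤ ∑ x ∈ M, searchProb O M k s
        (if ε ≤ p then iterations (Real.arcsin √p) else 0) (some x) := by
      intro hM
      obtain ⟨θ, hθ, hθ0, hθ1, hθs, hθp⟩ := hgeom hM
      have h1 := sum_searchProb_ge (k := k) hP hπ hrev O hδ hδ1 hs8 hθp
        (hsε.trans_le hθs).ne' (if ε ≤ p then iterations (Real.arcsin √p) else 0)
      have h2 := herr _ ((hT p).trans (by linarith))
      have h3 := max_le_sin_sq_iterations hθ0 hθ1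
      rw [← hθp, hp hM] at h3
      have h4 : (if ε ≤ p then iterations (Real.arcsin √p) else 0) = iterations θ := by
        rw [if_pos (hp hM ▸ hMε hM), hθ, hp hM]
      rw [h4] at h1 h2 ⊢
      linarith
    refine ⟨⟨?_, fun hM => ?_⟩, findsMarked_repeatProb (c := 1 / 8) (searchProb_nonneg O M _ _)
      (hsum _) (fun hM => ?_) hrη⟩
    · intro hM
      have h1 := hsum (if ε ≤ p then iterations (Real.arcsin √p) else 0)
      subst hM
      simpa using h1
    · linarith [hsucc hM]
    -- The larger of p and 1 - p is at least 1/2.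
    · linarith [hsucc hM, le_max_left p (1 - p), le_max_right p (1 - p)]
  · refine findsMarked_repeatProb (c := 1 / 8) ?_ (randomSearchProb_none_add O hπ hpos M hm0)
      (fun hM => ?_) hrη
    · exact div_nonneg (Finset.sum_nonneg fun t _ => searchProb_nonneg O M t _) (Nat.cast_nonneg m)
    · obtain ⟨θ, -, hθ0, hθ1, hθs, hθp⟩ := hgeom hM
      have hm' : (0 : ℝ) < m := by exact_mod_cast hm0
      rw [sum_randomSearchProb, le_div_iff₀ hm']
      have h1 : ∑ t ∈ Finset.range m, (Real.sin ((2 * t + 1) * θ) ^ 2 - η') ≤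
          ∑ t ∈ Finset.range m, ∑ x ∈ M, searchProb O M k s t (some x) := by
        refine Finset.sum_le_sum fun t ht => ?_
        have h2 := sum_searchProb_ge (k := k) hP hπ hrev O hδ hδ1 hs8 hθp
          (hsε.trans_le hθs).ne' t
        have h3 : (t : ℝ) ≤ m := by exact_mod_cast (Finset.mem_range.1 ht).le
        linarith [herr t (h3.trans hm2)]
      refine le_trans ?_ h1
      -- The choice m ≥ 1/√ε is what the averaging bound needs, as sin θ ≥ √ε.
      have h4 : 1 / (m : ℝ) ≤ Real.sin θ := by
        refine le_trans ?_ hθs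
        rw [div_le_iff₀ hm']
        rwa [div_le_iff₀' hsε] at hm1
      have h5 := sum_sin_sq_ge hθ0 hθ1 hm0 h4
      rw [Finset.sum_sub_distrib, Finset.sum_const, Finset.card_range, nsmul_eq_mul]
      nlinarith
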